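/- **Conventions.** Let $G$ be a group, $X\subseteq G$ a subset and $\{H_\lambda\}_{\lambda\in\Lambda}$ a family of subgroups of $G$ ($X$ and $\Lambda$ may be infinite) such that $X\cup\bigcup_\lambda H_\lambda$ generates $G$. Let $\mathcal H=\bigsqcup_{\lambda}(H_\lambda\setminus\{1\})$ (disjoint union of sets of labels), and let $\Gamma=\Gamma(G,X\sqcup\mathcal H)$ be the Cayley graph with vertex set $G$ and one positive edge from $v$ to $vs$ for each $v\in G$ and each label $s\in X\sqcup\mathcal H$ (loops and multiple edges allowed); paths may run through edges in both directions, and all edges have length $1$. For $h\in H_\lambda$ let $\widehat d_\lambda(1,h)\in[0,\infty]$ be the least length of a path in $\Gamma$ from $1$ to $h$ that contains no edge of the subgraph $\Gamma(H_\lambda,H_\lambda\setminus\{1\})$ ($\infty$ if there is none). For $f,g\in G$ put $\widehat d_\lambda(f,g)=\widehat d_\lambda(1,f^{-1}g)$ if $f^{-1}g\in H_\lambda$, and $\widehat d_\lambda(f,g)=\infty$ otherwise. The family $\{H_\lambda\}$ is *hyperbolically embedded in* $(G,X)$ if $X\cup\bigcup_\lambda H_\lambda$ generates $G$, if $\Gamma$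 is hyperbolic (there is $\delta$ such that in every geodesic triangle of $\Gamma$ with corners in $G$ each vertex on one side is within distance $\delta$ of a vertex on one of the other two sides), and if for all $\lambda$ and $n\in\mathbb N$ the set $\{h\in H_\lambda:\widehat d_\lambda(1,h)\le n\}$ is finite. An *$H_\lambda$-component* of a path $p$ is a nontrivial maximal subpath $a$ of $p$ all of whose labels lie in $H_\lambda\setminus\{1\}$, this set being taken as a summand of $\mathcal H$; $a_-$ and $a_+$ denote its endpoints. For a closed path, subpaths of cyclic shifts are also considered. A component of a closed path is *isolated* if no other $H_\lambda$-component of the path lies in the same left coset of $H_\lambda$. A path *penetrates* $xH_\lambda$ if it has an $H_\lambda$-component $a$ with $a_-\in xH_\lambda$; if the path $p$ is geodesic, $a$ is unique, and one writes $p_{in}(xH_\lambda)=a_-$, $p_{out}(xH_\lambda)=a_+$. Call $C>0$ a *polygon constant* if $\widehat d_\lambda(a_-,a_+)\le nC$ for every $n$, every geodesic $n$-gon in $\Gamma$ (a closed path that is a concatenation of $n$ geodesics), every $\lambda$ and every isolated $H_\lambda$-component $a$ of it. For $D>0$, a coset $xH_\lambda$ is *$(f,g;D)$-separating* if some geodesic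 in $\Gamma$ from $f$ to $g$ has an $H_\lambda$-component $a$ with $a_-\in xH_\lambda$ and $\widehat d_\lambda(a_-,a_+)>D$. The set of these cosets is $S_\lambda(f,g;D)$. For a unitary representation $\pi$ of a group $G$ on a Hilbert space $\mathcal K$, an *array* on $G$ into $(\mathcal K,\pi)$ is a map $r\colon G\to\mathcal K$ such that $\pi_g(r(g^{-1}))=-r(g)$ for all $g\in G$ and $\sup_{h\in G}\|r(gh)-\pi_g(r(h))\|<\infty$ for every $g\in G$. The left regular representation $\lambda_G$ on the complex Hilbert space $\ell^2(G)$ is $(\lambda_G(g)\xi)(x)=\xi(g^{-1}x)$. **Proposition.** Suppose that $\{H_\lambda\}_{\lambda\in\Lambda}$ is hyperbolically embedded in $(G,X)$. Then a polygon constant exists. Moreover, let $C>0$ be any polygon constant and let $D\ge 3C$. For every $\mu\in\Lambda$ and every array $r$ on $H_\mu$ into $(\ell^2(H_\mu),\lambda_{H_\mu})$, there are an array $R$ on $G$ into $(\ell^2(G),\lambda_G)$ and a constant $K\ge 0$ such that, for every $g\in G$, every separating coset $xH_\mu\in S_\mu(1,g;D)$ and every geodesic path $p$ in $\Gamma$ from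 $1$ to $g$, the path $p$ penetrates $xH_\mu$ and $$\bigl\|r\bigl(p_{in}(xH_\mu)^{-1}p_{out}(xH_\mu)\bigr)\bigr\|_2\le\|R(g)\|_2+K .$$ -/

import Mathlib

open scoped NNReal ENNReal

noncomputable section

/-! ### Arrays and the left regular representation -/

/-- An array on `G` into the unitary representation `(K, π)`. -/
structure IsArray {G : Type*} [Group G] {K : Type*} [NormedAddCommGroup K]
    [InnerProductSpace ℂ K] [CompleteSpace K] (π : G →* (K ≃ₗᵢ[ℂ] K)) (r : G → K) : Prop where
  antisymm : ∀ g : G, π g (r g⁻¹) = -r g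
  bounded : ∀ g : G, BddAbove (Set.range fun h : G => ‖r (g * h) - π g (r h)‖)

/-- The complex Hilbert space of square summable functions on `S`. -/
abbrev EllTwo (S : Type*) : Type _ := lp (fun _ : S => ℂ) 2

theorem memℓp_ellTwoTranslate {G : Type*} [Group G] (g : G) (ξ : EllTwo G) :
    Memℓp (fun x : G => (ξ : G → ℂ) (g⁻¹ * x)) 2 := by
  have h := lp.memℓp ξ
  rw [memℓp_gen_iff (by norm_num)] at h ⊢
  exact (Equiv.mulLeft g⁻¹).summable_iff.mpr h

/-- Left translation by `g` on square summable functions: the value at `x` is `ξ (g⁻¹ x)`. -/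
def ellTwoTranslate {G : Type*} [Group G] (g : G) (ξ : EllTwo G) : EllTwo G :=
  ⟨fun x => (ξ : G → ℂ) (g⁻¹ * x), memℓp_ellTwoTranslate g ξ⟩

@[simp] theorem ellTwoTranslate_apply {G : Type*} [Group G] (g : G) (ξ : EllTwo G) (x : G) :
    (ellTwoTranslate g ξ : G → ℂ) x = (ξ : G → ℂ) (g⁻¹ * x) := rfl

theorem norm_ellTwoTranslate {G : Type*} [Group G] (g : G) (ξ : EllTwo G) :
    ‖ellTwoTranslate g ξ‖ = ‖ξ‖ := by
  rw [lp.norm_eq_tsum_rpow (by norm_num), lp.norm_eq_tsum_rpow (by norm_num)]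
  congr 1
  exact (Equiv.mulLeft g⁻¹).tsum_eq fun x => ‖(ξ : G → ℂ) x‖ ^ (2 : ℝ≥0∞).toReal

/-- Left translation as a unitary operator. -/
def ellTwoTranslateIso {G : Type*} [Group G] (g : G) : EllTwo G ≃ₗᵢ[ℂ] EllTwo G where
  toFun := ellTwoTranslate g
  invFun := ellTwoTranslate g⁻¹
  left_inv ξ := by ext x; simp
  right_inv ξ := by ext x; simp
  map_add' ξ η := by ext x; simp
  map_smul' c ξ := by ext x; simp
  norm_map' := norm_ellTwoTranslate g

/-- The left regular representation of `G` on the square summable functions on `G`. -/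
def leftRegular (G : Type*) [Group G] : G →* (EllTwo G ≃ₗᵢ[ℂ] EllTwo G) where
  toFun := ellTwoTranslateIso
  map_one' := by
    ext ξ x
    simp [ellTwoTranslateIso]
  map_mul' g h := by
    ext ξ x
    simp [ellTwoTranslateIso, mul_assoc]

/-! ### The relative Cayley graph

The vertices are the elements of `G`, and there is one positive edge from `v` to `v * s` for every
vertex `v` and every letter `s` of the disjoint union of `X` and of the sets `H i \ {1}`.
A path is given by its initial vertex together with a word in oriented letters. -/

namespace RelCayley

variable {G : Type*} [Group G] {Λ : Type*}

/-- Letters: the disjoint union of `X` and of all the `H i \ {1}`. -/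
inductive Letter (X : Set G) (H : Λ → Subgroup G) where
  | base (x : X) : Letter X H
  | periph (i : Λ) (h : H i) (hne : h ≠ 1) : Letter X H

/-- The element of `G` that a letter stands for. -/
def Letter.toGroup {X : Set G} {H : Λ → Subgroup G} : Letter X H → G
  | .base x => x
  | .periph _ h _ => h

/-- A letter with a direction: `true` means that the edge is run through from `v` to `v * s`,
and `false` that an edge is run through backwards, from `v` to `v * s⁻¹`. -/
abbrev OLetter (X : Set G) (H : Λ → Subgroup G) : Type _ := Letter X H × Bool

variable {X : Set G} {H : Λ → Subgroup G}

/-- The group element by which the oriented letter moves a vertex. -/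
def OLetter.val (s : OLetter X H) : G := if s.2 then s.1.toGroup else s.1.toGroup⁻¹

/-- The label of the edge belongs to the summand `H i \ {1}` of the alphabet. -/
def OLetter.IsPeriph (i : Λ) (s : OLetter X H) : Prop :=
  ∃ (h : H i) (hne : h ≠ 1), s.1 = Letter.periph i h hne

/-- The path with initial vertex `f` and word `w` ends in `f * eval w`. -/
def eval (w : List (OLetter X H)) : G := (w.map OLetter.val).prod

/-- `w` labels a geodesic path (this does not depend on the initial vertex). -/
def IsGeodesicWord (w : List (OLetter X H)) : Prop :=
  ∀ w' : List (OLetter X H), eval w' = eval w → w.length ≤ w'.length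

/-- The path with initial vertex `f` and word `w` is a geodesic from `f` to `g`. -/
def IsGeodesic (f g : G) (w : List (OLetter X H)) : Prop :=
  f * eval w = g ∧ IsGeodesicWord w

/-- The vertices of the path with initial vertex `f` and word `w`. -/
def vertices (f : G) (w : List (OLetter X H)) : Set G :=
  {v | ∃ w₁ w₂, w = w₁ ++ w₂ ∧ v = f * eval w₁}

variable (X H) in
/-- The relative Cayley graph is hyperbolic: for some `δ`, every vertex on a side of a geodesic
triangle is at distance at most `δ` from a vertex on one of the other two sides. -/
def IsHyperbolic : Prop :=
  ∃ δ : ℕ, ∀ (x y z : G) (p q r : List (OLetter X H)),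
    IsGeodesic x y p → IsGeodesic x z q → IsGeodesic z y r →
      ∀ a ∈ vertices x p, ∃ b ∈ vertices x q ∪ vertices z r,
        ∃ w : List (OLetter X H), a * eval w = b ∧ w.length ≤ δ

/-- The path with initial vertex `f` and word `w` contains no edge of the Cayley graph of `H i`
with respect to `H i \ {1}`. -/
def IsAdmissible (i : Λ) (f : G) (w : List (OLetter X H)) : Prop :=
  ∀ w₁ s w₂, w = w₁ ++ s :: w₂ → OLetter.IsPeriph i s → f * eval w₁ ∉ H i

variable (X H) in
/-- The relative metric of `H i`, extended to `G`: if `f⁻¹ * g ∈ H i`, the least length of an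
admissible path from `1` to `f⁻¹ * g` (infinite if there is none), and otherwise infinite. -/
def relMetric (i : Λ) (f g : G) : ℝ≥0∞ :=
  ⨅ (_ : f⁻¹ * g ∈ H i) (w : List (OLetter X H)) (_ : IsAdmissible i 1 w ∧ eval w = f⁻¹ * g),
    (w.length : ℝ≥0∞)

variable (X H) in
/-- The family `H` is hyperbolically embedded in `(G, X)`. -/
structure IsHypEmbedded : Prop where
  generates : Subgroup.closure (X ∪ ⋃ i, (H i : Set G)) = ⊤
  hyperbolic : IsHyperbolic X H
  locallyFinite : ∀ (i : Λ) (n : ℕ), {h : G | h ∈ H i ∧ relMetric X H i 1 h ≤ n}.Finite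

/-- In the path with word `w₁ ++ a ++ w₂` the nontrivial subpath `a` is a maximal subpath whose
labels are all in `H i`. -/
def IsComponent (i : Λ) (w₁ a w₂ : List (OLetter X H)) : Prop :=
  a ≠ [] ∧ (∀ s ∈ a, OLetter.IsPeriph i s) ∧
    (∀ s ∈ w₁.getLast?, ¬ OLetter.IsPeriph i s) ∧ (∀ s ∈ w₂.head?, ¬ OLetter.IsPeriph i s)

/-- The path with initial vertex `f` and word `w` has an `H i`-component that starts in `u`, ends
in `v`, and lies in the coset `c`; so the path penetrates `c`, and `u` and `v` are its entrance
and exit points. -/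
def Penetrates (i : Λ) (f : G) (w : List (OLetter X H)) (c : G ⧸ H i) (u v : G) : Prop :=
  ∃ w₁ a w₂, w = w₁ ++ a ++ w₂ ∧ IsComponent i w₁ a w₂ ∧
    u = f * eval w₁ ∧ v = u * eval a ∧ (u : G ⧸ H i) = c

theorem eval_mem {i : Λ} {a : List (OLetter X H)} (h : ∀ s ∈ a, OLetter.IsPeriph i s) :
    eval a ∈ H i := by
  refine Subgroup.list_prod_mem _ fun x hx => ?_
  obtain ⟨⟨l, b⟩, hs, rfl⟩ := List.mem_map.1 hx
  obtain ⟨k, hne, hk⟩ := h _ hs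
  dsimp only at hk
  subst hk
  cases b <;> simp [OLetter.val, Letter.toGroup]

theorem Penetrates.mem {i : Λ} {f : G} {w : List (OLetter X H)} {c : G ⧸ H i} {u v : G}
    (h : Penetrates i f w c u v) : u⁻¹ * v ∈ H i := by
  obtain ⟨w₁, a, w₂, -, ha, -, rfl, -⟩ := h
  simpa using eval_mem ha.2.1

variable (X H) in
/-- The coset `c` of `H i` is `(f, g; D)`-separating: some geodesic from `f` to `g` essentially
penetrates it. -/
def IsSeparating (i : Λ) (D : ℝ≥0) (f g : G) (c : G ⧸ H i) : Prop :=
  ∃ w : List (OLetter X H), IsGeodesic f g w ∧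
    ∃ u v, Penetrates i f w c u v ∧ (D : ℝ≥0∞) < relMetric X H i u v

/-- The closed path with initial vertex `f` and word `w` has an isolated `H i`-component from `u`
to `v`. Components of a closed path are taken up to cyclic shifts: `a ++ b` is a cyclic shift of
`w`, starting in `u`, and `a` is maximal; the remaining components are then those of `b`, and none
of them lies in the coset of `u`. -/
def HasIsolatedComponent (i : Λ) (f : G) (w : List (OLetter X H)) (u v : G) : Prop :=
  ∃ p q a b, w = p ++ q ∧ q ++ p = a ++ b ∧
    a ≠ [] ∧ (∀ s ∈ a, OLetter.IsPeriph i s) ∧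
    (∀ s ∈ b.head?, ¬ OLetter.IsPeriph i s) ∧ (∀ s ∈ b.getLast?, ¬ OLetter.IsPeriph i s) ∧
    u = f * eval p ∧ v = u * eval a ∧
    ∀ b₁ c b₂, b = b₁ ++ c ++ b₂ → IsComponent i b₁ c b₂ →
      ((v * eval b₁ : G) : G ⧸ H i) ≠ (u : G ⧸ H i)

variable (X H) in
/-- `C` is a polygon constant: for every geodesic `n`-gon (a closed path which is a concatenation
of `n` geodesics) and each of its isolated components, the relative distance between the
endpoints of that component is at most `n * C`. -/
def IsPolygonConstant (C : ℝ≥0) : Prop :=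
  ∀ (f : G) (sides : List (List (OLetter X H))),
    (∀ w ∈ sides, IsGeodesicWord w) → eval sides.flatten = 1 →
      ∀ (i : Λ) (u v : G), HasIsolatedComponent i f sides.flatten u v →
        relMetric X H i u v ≤ (sides.length : ℝ≥0∞) * (C : ℝ≥0∞)

end RelCayley

end

/-! The array is built from nearest-point projections. A coset of `H i` has diameter at most 1 in
the relative Cayley graph, so a geodesic from `f` to `g` with an edge in a coset `c` enters `c` at a
point nearest to `f` and leaves it at a point nearest to `g` (`IsGeodesic.edge_in_coset`).
Conversely, if a geodesic has no edge in `c`, thin triangles join the projections of its endpoints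
by a path of length at most `16 * δ + 9` without edges in `c` (`joined_proj`). Applied side by side,
this gives a polygon constant. Together with local finiteness it makes each projection a finite set.

For `u`, `v` in one coset, `pairVec r u v` is `r (u⁻¹ v)` transported to that coset. The array is `R
g = farSum X D r 1 g`: over all cosets `c` that are far between `1` and `g`, it adds up the average
of `pairVec r u v` over all projections `u` of `1` and `v` of `g`. Averaging avoids choices, so the
sum is equivariant and antisymmetric in the pair of points. Terms of different cosets have disjoint
supports, hence each is bounded in norm by `R g`. Each term is also uniformly close to `pairVec r u
v` for the entrance and exit points of any geodesic, which gives the inequality.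

It remains to bound `farSum f k - farSum g k` uniformly in `k`. Fix a geodesic `γ` from `f` to `g`;
it meets finitely many cosets. If `γ` avoids `c` and `c` is far between `f` and `k`, an isolated
component in a geodesic triangle would have relative length at most `3 * C ≤ D`, so every geodesic
from `g` to `k` meets `c` as well (`IsFar.not_avoids_or`). Among all such cosets, take the one
farthest from `k`. It separates the others from both `f` and `g`, so their projections from `f` and
`g` coincide and their terms cancel (`exists_forall_proj_eq`). Boundedly many terms are left, and
each of them is bounded by the array property of `r`. -/

noncomputable section

namespace RelCayley

variable {G : Type*} [Group G] {Λ : Type*} {X : Set G} {H : Λ → Subgroup G}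

/-! ### Words -/

@[simp] theorem eval_nil : eval ([] : List (OLetter X H)) = 1 := rfl

@[simp] theorem eval_cons (s : OLetter X H) (w : List (OLetter X H)) :
    eval (s :: w) = s.val * eval w := by simp [eval]

@[simp] theorem eval_append (w w' : List (OLetter X H)) :
    eval (w ++ w') = eval w * eval w' := by simp [eval]

/-- The word read along the reversed path. -/
def invWord (w : List (OLetter X H)) : List (OLetter X H) :=
  (w.map fun s => ((s.1, !s.2) : OLetter X H)).reverse

@[simp] theorem invWord_nil : invWord ([] : List (OLetter X H)) = [] := rfl

@[simp] theorem invWord_cons (s : OLetter X H) (w : List (OLetter X H)) :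
    invWord (s :: w) = invWord w ++ [((s.1, !s.2) : OLetter X H)] := by simp [invWord]

@[simp] theorem length_invWord (w : List (OLetter X H)) :
    (invWord w).length = w.length := by simp [invWord]

@[simp] theorem invWord_append (w w' : List (OLetter X H)) :
    invWord (w ++ w') = invWord w' ++ invWord w := by simp [invWord]

@[simp] theorem invWord_invWord (w : List (OLetter X H)) : invWord (invWord w) = w := by
  induction w with
  | nil => rfl
  | cons s w ih => simp [ih]

theorem val_flip (s : OLetter X H) : OLetter.val ((s.1, !s.2) : OLetter X H) = s.val⁻¹ := by
  obtain ⟨l, b⟩ := s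
  cases b <;> simp [OLetter.val]

@[simp] theorem eval_invWord (w : List (OLetter X H)) : eval (invWord w) = (eval w)⁻¹ := by
  induction w with
  | nil => simp
  | cons s w ih => simp [ih, val_flip]

theorem val_mem {i : Λ} {s : OLetter X H} (h : OLetter.IsPeriph i s) : s.val ∈ H i := by
  simpa using eval_mem (a := [s]) (by simpa using h)

theorem mk_mul_val {i : Λ} {s : OLetter X H} (h : OLetter.IsPeriph i s) (f : G) :
    ((f * s.val : G) : G ⧸ H i) = f :=
  QuotientGroup.mk_mul_of_mem f (val_mem h)

/-- The one letter word for a nontrivial element of `H i`. -/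
theorem exists_periph_letter {i : Λ} {h : G} (hh : h ∈ H i) (hne : h ≠ 1) :
    ∃ s : OLetter X H, OLetter.IsPeriph i s ∧ s.val = h := by
  have hne' : (⟨h, hh⟩ : H i) ≠ 1 := fun e => hne (congrArg Subtype.val e)
  exact ⟨(Letter.periph i ⟨h, hh⟩ hne', true), ⟨_, hne', rfl⟩, by simp [OLetter.val, Letter.toGroup]⟩

/-! ### Paths avoiding the edges of a coset -/

/-- The path with initial vertex `f` and word `w` has no edge labelled by `H i` in the coset `c`. -/
def Avoids {i : Λ} (c : G ⧸ H i) : G → List (OLetter X H) → Prop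
  | _, [] => True
  | f, s :: w => (OLetter.IsPeriph i s → (f : G ⧸ H i) ≠ c) ∧ Avoids c (f * s.val) w

section Avoids

variable {i : Λ} {c : G ⧸ H i}

@[simp] theorem avoids_nil (f : G) : Avoids c f ([] : List (OLetter X H)) := trivial

@[simp] theorem avoids_cons {f : G} {s : OLetter X H} {w : List (OLetter X H)} :
    Avoids c f (s :: w) ↔
      (OLetter.IsPeriph i s → (f : G ⧸ H i) ≠ c) ∧ Avoids c (f * s.val) w := Iff.rfl

@[simp] theorem avoids_append {f : G} {w w' : List (OLetter X H)} :
    Avoids c f (w ++ w') ↔ Avoids c f w ∧ Avoids c (f * eval w) w' := by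
  induction w generalizing f with
  | nil => simp
  | cons s w ih => simp [ih, and_assoc, mul_assoc]

theorem not_avoids_iff {f : G} {w : List (OLetter X H)} :
    ¬ Avoids c f w ↔
      ∃ x s y, w = x ++ s :: y ∧ OLetter.IsPeriph i s ∧ ((f * eval x : G) : G ⧸ H i) = c := by
  constructor
  · intro h
    induction w generalizing f with
    | nil => exact absurd trivial h
    | cons s w ih =>
      by_cases h1 : OLetter.IsPeriph i s ∧ (f : G ⧸ H i) = c
      · exact ⟨[], s, w, rfl, h1.1, by simpa using h1.2⟩
      · have h2 : ¬ Avoids c (f * s.val) w := fun h2 => h ⟨fun hs e => h1 ⟨hs, e⟩, h2⟩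
        obtain ⟨x, t, y, rfl, ht, hx⟩ := ih h2
        exact ⟨s :: x, t, y, rfl, ht, by simpa [mul_assoc] using hx⟩
  · rintro ⟨x, s, y, rfl, hs, hx⟩ h
    rw [avoids_append] at h
    exact h.2.1 hs hx

/-- An edge labelled by `H i` has both ends in the same coset, so reversing it does not change the
coset in which it lies. -/
theorem Avoids.invWord {f : G} {w : List (OLetter X H)} (h : Avoids c f w) :
    Avoids c (f * eval w) (invWord w) := by
  induction w generalizing f with
  | nil => simp
  | cons s w ih =>
    have h2 := ih h.2
    rw [invWord_cons, avoids_append, eval_cons, ← mul_assoc]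
    refine ⟨h2, ?_, trivial⟩
    intro hs
    have hs' : OLetter.IsPeriph i s := hs
    simpa [mk_mul_val hs'] using h.1 hs'

theorem Avoids.invWord' {f g : G} {w : List (OLetter X H)} (h : Avoids c f w)
    (hg : f * eval w = g) : Avoids c g (RelCayley.invWord w) := hg ▸ h.invWord

/-- There is a path from `u` to `v` of length at most `n` without edges in the coset `c`. -/
def Joined (X : Set G) {H : Λ → Subgroup G} {i : Λ} (c : G ⧸ H i) (u v : G) (n : ℕ) : Prop :=
  ∃ w : List (OLetter X H), u * eval w = v ∧ Avoids c u w ∧ w.length ≤ n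

theorem Joined.symm {u v : G} {n : ℕ} (h : Joined X c u v n) : Joined X c v u n := by
  obtain ⟨w, rfl, hw, hn⟩ := h
  exact ⟨RelCayley.invWord w, by simp, hw.invWord, by simpa using hn⟩

theorem Joined.trans {u v x : G} {m n : ℕ} (h : Joined X c u v m) (h' : Joined X c v x n) :
    Joined X c u x (m + n) := by
  obtain ⟨w, rfl, hw, hn⟩ := h
  obtain ⟨w', rfl, hw', hn'⟩ := h'
  exact ⟨w ++ w', by simp [mul_assoc], by simp [hw, hw'], by simp; omega⟩

theorem Joined.mono {u v : G} {m n : ℕ} (h : Joined X c u v m) (hmn : m ≤ n) :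
    Joined X c u v n := by
  obtain ⟨w, hw, hw', hn⟩ := h
  exact ⟨w, hw, hw', hn.trans hmn⟩

/-- Translation by `u⁻¹` carries `c` to `H i` and turns avoidance of `c` into admissibility. -/
theorem relMetric_le_length {u v : G} {w : List (OLetter X H)} (hw : Avoids c u w)
    (huv : u * eval w = v) (hu : (u : G ⧸ H i) = c) (hv : (v : G ⧸ H i) = c) :
    relMetric X H i u v ≤ w.length := by
  have hmem : u⁻¹ * v ∈ H i := QuotientGroup.eq.1 (hu.trans hv.symm)
  refine iInf_le_of_le hmem (iInf₂_le_of_le w ⟨?_, by simp [← huv]⟩ le_rfl)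
  intro x s y hxy hs hx
  refine not_avoids_iff.2 ⟨x, s, y, hxy, hs, ?_⟩ hw
  rw [← hu]
  exact QuotientGroup.mk_mul_of_mem u (by simpa using hx)

theorem Joined.relMetric_le {u v : G} {n : ℕ} (h : Joined X c u v n)
    (hu : (u : G ⧸ H i) = c) (hv : (v : G ⧸ H i) = c) : relMetric X H i u v ≤ n := by
  obtain ⟨w, huv, hw, hn⟩ := h
  exact (relMetric_le_length hw huv hu hv).trans (by exact_mod_cast hn)

end Avoids

/-! ### Invariance and symmetry of the relative metric. -/

theorem relMetric_eq_one_left (i : Λ) (u v : G) :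
    relMetric X H i u v = relMetric X H i 1 (u⁻¹ * v) := by simp [relMetric]

theorem relMetric_mul_left (i : Λ) (g u v : G) :
    relMetric X H i (g * u) (g * v) = relMetric X H i u v := by
  simp [relMetric, mul_assoc]

theorem relMetric_le_symm (i : Λ) (u v : G) : relMetric X H i u v ≤ relMetric X H i v u := by
  refine le_iInf fun hm => le_iInf₂ fun w hw => ?_
  have huv : (v : G ⧸ H i) = u := QuotientGroup.eq.2 hm
  have hav : Avoids (v : G ⧸ H i) v w := by
    by_contra hcon
    obtain ⟨x, s, y, hxy, hs, hx⟩ := not_avoids_iff.1 hcon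
    refine hw.1 x s y hxy hs ?_
    simpa using QuotientGroup.eq.1 hx.symm
  have he : v * eval w = u := by simp [hw.2]
  have := relMetric_le_length (hav.invWord' he) (v := v) (by simp [hw.2]) huv.symm rfl
  simpa using this

theorem relMetric_comm (i : Λ) (u v : G) : relMetric X H i u v = relMetric X H i v u :=
  le_antisymm (relMetric_le_symm i u v) (relMetric_le_symm i v u)

theorem relMetric_self (i : Λ) (u : G) : relMetric X H i u u = 0 := by
  simpa using relMetric_le_length (X := X) (H := H) (i := i) (c := (u : G ⧸ H i)) (u := u) (v := u)
    (w := []) trivial (by simp) rfl rfl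

/-! ### The word metric -/

variable (X H) in
/-- Every element of `G` is represented by a word. -/
def IsConnected : Prop := ∀ g : G, ∃ w : List (OLetter X H), eval w = g

theorem isConnected_of_closure (h : Subgroup.closure (X ∪ ⋃ i, (H i : Set G)) = ⊤) :
    IsConnected X H := by
  intro g
  have hg : g ∈ Subgroup.closure (X ∪ ⋃ i, (H i : Set G)) := h ▸ Subgroup.mem_top g
  induction hg using Subgroup.closure_induction with
  | mem x hx =>
    rcases hx with hx | hx
    · exact ⟨[(Letter.base ⟨x, hx⟩, true)], by simp [OLetter.val, Letter.toGroup]⟩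
    · obtain ⟨i, hi⟩ := Set.mem_iUnion.1 hx
      by_cases h1 : x = 1
      · exact ⟨[], by simp [h1]⟩
      · obtain ⟨s, -, hs⟩ := exists_periph_letter (X := X) hi h1
        exact ⟨[s], by simp [hs]⟩
  | one => exact ⟨[], rfl⟩
  | mul x y _ _ hx hy =>
    obtain ⟨w, rfl⟩ := hx
    obtain ⟨w', rfl⟩ := hy
    exact ⟨w ++ w', by simp⟩
  | inv x _ hx =>
    obtain ⟨w, rfl⟩ := hx
    exact ⟨invWord w, by simp⟩

variable (X H) in
/-- The distance in the relative Cayley graph. -/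
def wordDist (f g : G) : ℕ := sInf {n | ∃ w : List (OLetter X H), f * eval w = g ∧ w.length = n}

theorem wordDist_le {f g : G} {w : List (OLetter X H)} (h : f * eval w = g) :
    wordDist X H f g ≤ w.length := Nat.sInf_le ⟨w, h, rfl⟩

theorem wordDist_mul_left (h f g : G) : wordDist X H (h * f) (h * g) = wordDist X H f g := by
  simp [wordDist, mul_assoc]

@[simp] theorem wordDist_self (f : G) : wordDist X H f f = 0 := by
  simpa using wordDist_le (X := X) (H := H) (f := f) (g := f) (w := []) (by simp)

theorem exists_word (hc : IsConnected X H) (f g : G) :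
    ∃ w : List (OLetter X H), f * eval w = g ∧ w.length = wordDist X H f g := by
  obtain ⟨w, hw⟩ := hc (f⁻¹ * g)
  exact Nat.sInf_mem (s := {n | ∃ w : List (OLetter X H), f * eval w = g ∧ w.length = n})
    ⟨_, w, by simp [hw], rfl⟩

theorem isGeodesic_iff (hc : IsConnected X H) {f g : G} {w : List (OLetter X H)} :
    IsGeodesic f g w ↔ f * eval w = g ∧ w.length = wordDist X H f g := by
  constructor
  · rintro ⟨h, hw⟩
    refine ⟨h, le_antisymm ?_ (wordDist_le h)⟩
    obtain ⟨w', h', hl⟩ := exists_word hc f g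
    exact hl ▸ hw w' (mul_left_cancel (h'.trans h.symm))
  · rintro ⟨h, hl⟩
    exact ⟨h, fun w' hw' => hl ▸ wordDist_le (by rw [hw', h])⟩

theorem exists_isGeodesic (hc : IsConnected X H) (f g : G) :
    ∃ w : List (OLetter X H), IsGeodesic f g w := by
  obtain ⟨w, hw⟩ := exists_word hc f g
  exact ⟨w, (isGeodesic_iff hc).2 hw⟩

theorem wordDist_comm (hc : IsConnected X H) (f g : G) :
    wordDist X H f g = wordDist X H g f := by
  have key : ∀ f g : G, wordDist X H f g ≤ wordDist X H g f := by
    intro f g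
    obtain ⟨w, hw, hl⟩ := exists_word hc g f
    rw [← hl, ← length_invWord]
    exact wordDist_le (by simp [← hw])
  exact le_antisymm (key f g) (key g f)

theorem wordDist_triangle (hc : IsConnected X H) (f g h : G) :
    wordDist X H f h ≤ wordDist X H f g + wordDist X H g h := by
  obtain ⟨w, rfl, hl⟩ := exists_word hc f g
  obtain ⟨w', rfl, hl'⟩ := exists_word hc (f * eval w) h
  rw [← hl, ← hl', ← List.length_append]
  exact wordDist_le (by simp [mul_assoc])

/-- Every nontrivial element of `H i` is a letter, so cosets have diameter at most 1. -/
theorem wordDist_le_one {i : Λ} {u v : G} (h : (u : G ⧸ H i) = v) : wordDist X H u v ≤ 1 := by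
  by_cases huv : u = v
  · simp [huv]
  · obtain ⟨s, -, hs⟩ := exists_periph_letter (X := X) (QuotientGroup.eq.1 h)
      (fun e => huv (inv_mul_eq_one.1 e))
    simpa using wordDist_le (X := X) (H := H) (f := u) (g := v) (w := [s]) (by simp [hs])

theorem isGeodesicWord_invWord {w : List (OLetter X H)} (h : IsGeodesicWord w) :
    IsGeodesicWord (invWord w) := by
  intro w' hw'
  simpa using h (invWord w') (by simp [hw'])

theorem IsGeodesic.invWord {f g : G} {w : List (OLetter X H)} (h : IsGeodesic f g w) :
    IsGeodesic g f (invWord w) :=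
  ⟨by simp [← h.1], isGeodesicWord_invWord h.2⟩

theorem isGeodesicWord_of_infix {x m y : List (OLetter X H)} (h : IsGeodesicWord (x ++ m ++ y)) :
    IsGeodesicWord m := by
  intro w' hw'
  have := h (x ++ w' ++ y) (by simp [hw'])
  simp only [List.length_append] at this
  omega

/-- Consequently the components of a geodesic are single edges. -/
theorem IsGeodesicWord.length_le_one {i : Λ} {x m y : List (OLetter X H)}
    (h : IsGeodesicWord (x ++ m ++ y)) (hm : eval m ∈ H i) : m.length ≤ 1 := by
  have hm' := isGeodesicWord_of_infix h
  by_cases h1 : eval m = 1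
  · have := hm' [] (by simp [h1])
    simp at this
    simp [this]
  · obtain ⟨s, -, hs⟩ := exists_periph_letter (X := X) hm h1
    simpa using hm' [s] (by simp [hs])

/-! ### Nearest points in a coset -/

variable (X) in
/-- The distance from a vertex to a coset. -/
def cosetDist {i : Λ} (f : G) (c : G ⧸ H i) : ℕ :=
  sInf {n | ∃ u : G, (u : G ⧸ H i) = c ∧ wordDist X H f u = n}

variable (X) in
/-- The set of points of the coset `c` that are nearest to `f`. -/
def proj {i : Λ} (f : G) (c : G ⧸ H i) : Set G :=
  {u | (u : G ⧸ H i) = c ∧ wordDist X H f u = cosetDist X f c}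

variable {i : Λ} {c : G ⧸ H i}

theorem cosetDist_le {f u : G} (hu : (u : G ⧸ H i) = c) :
    cosetDist X f c ≤ wordDist X H f u := Nat.sInf_le ⟨u, hu, rfl⟩

theorem proj_nonempty (f : G) (c : G ⧸ H i) : (proj X f c).Nonempty := by
  obtain ⟨u, hu⟩ := QuotientGroup.mk_surjective c
  exact Nat.sInf_mem (s := {n | ∃ u : G, (u : G ⧸ H i) = c ∧ wordDist X H f u = n})
    ⟨_, u, hu, rfl⟩

theorem cosetDist_triangle (hc : IsConnected X H) (f g : G) (c : G ⧸ H i) :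
    cosetDist X f c ≤ wordDist X H f g + cosetDist X g c := by
  obtain ⟨u, hu, hd⟩ := proj_nonempty (X := X) g c
  rw [← hd]
  exact (cosetDist_le hu).trans (wordDist_triangle hc f g u)

theorem self_mem_proj {u : G} (hu : (u : G ⧸ H i) = c) : u ∈ proj X u c := by
  refine ⟨hu, le_antisymm ?_ (cosetDist_le hu)⟩
  simp

/-- An edge in `c` would start at a point of `c` reached in fewer than `cosetDist X f c` steps. -/
theorem avoids_of_length_le {f : G} {w : List (OLetter X H)} (h : w.length ≤ cosetDist X f c) :
    Avoids c f w := by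
  by_contra hcon
  obtain ⟨x, s, y, rfl, hs, hx⟩ := not_avoids_iff.1 hcon
  have h1 := cosetDist_le (X := X) (f := f) hx
  have h2 := wordDist_le (X := X) (H := H) (f := f) (w := x) rfl
  simp at h
  omega

theorem mk_smul_eq_iff (h u : G) : ((h * u : G) : G ⧸ H i) = h • c ↔ (u : G ⧸ H i) = c := by
  change h • (u : G ⧸ H i) = h • c ↔ _
  exact smul_left_cancel_iff h

theorem cosetDist_mul_left (h f : G) (c : G ⧸ H i) :
    cosetDist X (h * f) (h • c) = cosetDist X f c := by
  unfold cosetDist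
  congr 1
  ext n
  constructor
  · rintro ⟨u, hu, hn⟩
    refine ⟨h⁻¹ * u, ?_, ?_⟩
    · rw [← mk_smul_eq_iff h]; simpa using hu
    · rw [← hn, ← wordDist_mul_left h]; simp
  · rintro ⟨u, hu, hn⟩
    exact ⟨h * u, (mk_smul_eq_iff h u).2 hu, by rw [wordDist_mul_left, hn]⟩

theorem mul_mem_proj_iff (h f u : G) (c : G ⧸ H i) :
    h * u ∈ proj X (h * f) (h • c) ↔ u ∈ proj X f c := by
  simp only [proj, Set.mem_ofPred_eq, mk_smul_eq_iff, wordDist_mul_left, cosetDist_mul_left]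

/-! ### Projections of geodesics that avoid a coset -/

variable (X H) in
/-- Geodesic triangles of the relative Cayley graph are `δ`-thin. -/
def ThinTriangles (δ : ℕ) : Prop :=
  ∀ (x y z : G) (p q r : List (OLetter X H)),
    IsGeodesic x y p → IsGeodesic x z q → IsGeodesic z y r →
      ∀ a ∈ vertices x p, ∃ b ∈ vertices x q ∪ vertices z r,
        ∃ w : List (OLetter X H), a * eval w = b ∧ w.length ≤ δ

theorem mem_proj_of_length_le {f u : G} {w : List (OLetter X H)} (hw : f * eval w = u)
    (hl : w.length ≤ cosetDist X f c) (hu : (u : G ⧸ H i) = c) : u ∈ proj X f c :=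
  ⟨hu, le_antisymm ((wordDist_le hw).trans hl) (cosetDist_le hu)⟩

theorem exists_word_of_mem_proj (hc : IsConnected X H) {f u : G} (hu : u ∈ proj X f c) :
    ∃ s : List (OLetter X H), IsGeodesic f u s ∧ s.length = cosetDist X f c := by
  obtain ⟨s, hs, hl⟩ := exists_word hc f u
  exact ⟨s, (isGeodesic_iff hc).2 ⟨hs, hl⟩, hl.trans hu.2⟩

/-- A thin quadrilateral near one end of the coset: either the two projections are close, or the
first one is close to the geodesic. -/
theorem joined_proj_or_near {δ : ℕ} (hδ : ThinTriangles X H δ) (hc : IsConnected X H)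
    {f g u v : G} {q : List (OLetter X H)} (hq : IsGeodesic f g q)
    (hu : u ∈ proj X f c) (hv : v ∈ proj X g c) :
    Joined X c u v (8 * δ + 4) ∨
      ∃ q₁ q₂, q = q₁ ++ q₂ ∧ Joined X c u (f * eval q₁) (4 * δ + 2) := by
  obtain ⟨s, hs, hsl⟩ := exists_word_of_mem_proj hc hu
  obtain ⟨t, ht, htl⟩ := exists_word_of_mem_proj hc hv
  -- If `f` is this close to the coset, then `f` itself is the point of `q` near `u`.
  by_cases hK : cosetDist X f c ≤ 2 * δ + 2
  · right
    refine ⟨[], q, rfl, Joined.symm ⟨s, by simpa using hs.1, ?_, by omega⟩⟩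
    simpa using avoids_of_length_le (f := f) hsl.le
  -- Cut `s` at the point `y` at distance `2 * δ + 2` from `u`. Two applications of thinness move
  -- `y` by at most `2 * δ`, so those paths stay off the edges of `c`.
  obtain ⟨s₁, s₂, hs12, hs2⟩ : ∃ s₁ s₂, s = s₁ ++ s₂ ∧ s₂.length = 2 * δ + 2 :=
    ⟨s.take (s.length - (2 * δ + 2)), s.drop (s.length - (2 * δ + 2)), by simp, by
      simp; omega⟩
  subst hs12
  set y := f * eval s₁ with hy
  have hyu : y * eval s₂ = u := by rw [hy, mul_assoc, ← eval_append]; exact hs.1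
  have hy1 : 2 * δ + 2 ≤ cosetDist X y c := by
    have h1 := cosetDist_triangle hc f y c
    have h2 : wordDist X H f y ≤ s₁.length := wordDist_le rfl
    simp at hsl
    omega
  have hy2 : cosetDist X y c ≤ 2 * δ + 2 := by
    rw [← hs2]
    exact (cosetDist_le hu.1).trans (wordDist_le hyu)
  have hJy : Joined X c u y (2 * δ + 2) :=
    Joined.symm ⟨s₂, hyu, avoids_of_length_le (by omega), hs2.le⟩
  obtain ⟨d, hd⟩ := exists_isGeodesic hc f v
  obtain ⟨r, hr⟩ := exists_isGeodesic hc v u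
  obtain ⟨b, hb | hb, w, hw, hwl⟩ := hδ f u v _ d r hs hd hr y ⟨s₁, s₂, rfl, rfl⟩
  · obtain ⟨b', hb', w', hw', hwl'⟩ := hδ f v g d q t hd hq ht b hb
    have hJ : Joined X c y b' (2 * δ) :=
      ⟨w ++ w', by rw [eval_append, ← mul_assoc, hw, hw'],
        avoids_of_length_le (by simp; omega), by simp; omega⟩
    rcases hb' with ⟨q₁, q₂, hq12, rfl⟩ | ⟨t₁, t₂, ht12, rfl⟩
    · right
      exact ⟨q₁, q₂, hq12, (hJy.trans hJ).mono (by omega)⟩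
    -- Since `t` is a shortest path to `c`, its part after `b'` is no longer than the distance from
    -- `b'` to `c`, which is at most `2 * δ + (2 * δ + 2)`.
    · left
      have hta : Avoids c g t := avoids_of_length_le htl.le
      rw [ht12, avoids_append] at hta
      have h1 := cosetDist_triangle hc g (g * eval t₁) c
      have h2 : wordDist X H g (g * eval t₁) ≤ t₁.length := wordDist_le rfl
      have h3 := cosetDist_triangle hc (g * eval t₁) y c
      have h4 : wordDist X H (g * eval t₁) y ≤ 2 * δ := by
        obtain ⟨w₀, hw₀, -, hl₀⟩ := hJ.symm
        exact (wordDist_le hw₀).trans hl₀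
      have h5 : t₁.length + t₂.length = cosetDist X g c := by
        rw [← htl, ht12, List.length_append]
      have hJt : Joined X c (g * eval t₁) v t₂.length :=
        ⟨t₂, by rw [mul_assoc, ← eval_append, ← ht12]; exact ht.1, hta.2, le_rfl⟩
      exact ((hJy.trans hJ).trans hJt).mono (by omega)
  -- The side `r` has length at most 1 and starts in `c`, so `y` would be within `δ + 1` of the
  -- coset.
  · exfalso
    obtain ⟨r₁, r₂, hr12, rfl⟩ := hb
    have h1 := cosetDist_triangle hc y (v * eval r₁) c
    have h2 : wordDist X H y (v * eval r₁) ≤ w.length := wordDist_le hw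
    have h3 : cosetDist X (v * eval r₁) c ≤ 1 := by
      refine (cosetDist_le hv.1).trans ?_
      rw [wordDist_comm hc]
      refine (wordDist_le rfl).trans ?_
      have h4 := ((isGeodesic_iff hc).1 hr).2
      have h5 : wordDist X H v u ≤ 1 := wordDist_le_one (hv.1.trans hu.1.symm)
      rw [← h4, hr12, List.length_append] at h5
      omega
    omega

/-- The dichotomy is applied from both ends. If neither application joins the projections directly,
they are near points `b`, `b'` of `q`. These are at most `(4 * δ + 2) + 1 + (4 * δ + 2)` apart
because the coset has diameter at most 1, and the part of `q` between them avoids `c`. -/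
theorem joined_proj {δ : ℕ} (hδ : ThinTriangles X H δ) (hc : IsConnected X H)
    {f g u v : G} {q : List (OLetter X H)} (hq : IsGeodesic f g q) (hav : Avoids c f q)
    (hu : u ∈ proj X f c) (hv : v ∈ proj X g c) : Joined X c u v (16 * δ + 9) := by
  rcases joined_proj_or_near hδ hc hq hu hv with h | ⟨q₁, q₂, hq12, hJ⟩
  · exact h.mono (by omega)
  rcases joined_proj_or_near hδ hc hq.invWord hv hu with h | ⟨p₁, p₂, hp12, hJ'⟩
  · exact h.symm.mono (by omega)
  have hqp : q = invWord p₂ ++ invWord p₁ := by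
    rw [← invWord_append, ← hp12, invWord_invWord]
  have hg : g * eval p₁ = f * eval (invWord p₂) := by
    rw [← hq.1, hqp]
    simp [mul_assoc]
  rw [hg] at hJ'
  set b := f * eval q₁ with hb
  set b' := f * eval (invWord p₂) with hb'
  have hbb : wordDist X H b b' ≤ 8 * δ + 5 := by
    have hub : wordDist X H b u ≤ 4 * δ + 2 := by
      obtain ⟨w, hw, -, hl⟩ := hJ.symm
      exact (wordDist_le hw).trans hl
    have hvb : wordDist X H v b' ≤ 4 * δ + 2 := by
      obtain ⟨w, hw, -, hl⟩ := hJ'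
      exact (wordDist_le hw).trans hl
    have h1 := wordDist_triangle hc b u b'
    have h2 := wordDist_triangle hc u v b'
    have h3 : wordDist X H u v ≤ 1 := wordDist_le_one (hu.1.trans hv.1.symm)
    omega
  have hmid : Joined X c b b' (8 * δ + 5) := by
    have key : ∀ {x y x' y' : List (OLetter X H)}, q = x ++ y → q = x' ++ y' →
        x.length ≤ x'.length →
        Joined X c (f * eval x) (f * eval x') (wordDist X H (f * eval x) (f * eval x')) := by
      intro x y x' y' h h' hl
      obtain ⟨m, rfl⟩ : x <+: x' :=
        List.prefix_of_prefix_length_le ⟨y, h.symm⟩ ⟨y', h'.symm⟩ hl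
      rw [h', avoids_append, avoids_append] at hav
      refine ⟨m, by simp [mul_assoc], hav.1.2, ?_⟩
      have hm : IsGeodesicWord m := isGeodesicWord_of_infix (x := x) (y := y') (h' ▸ hq.2)
      obtain ⟨w, hw, hwl⟩ := exists_word hc (f * eval x) (f * eval (x ++ m))
      rw [← hwl]
      exact hm w (by simpa [mul_assoc] using hw)
    rcases le_total q₁.length (invWord p₂).length with h | h
    · exact (key hq12 hqp h).mono hbb
    · refine (key hqp hq12 h).symm.mono ?_
      rwa [wordDist_comm hc]
  exact ((hJ.trans hmid).trans hJ'.symm).mono (by omega)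

/-! ### Polygon constants -/

/-- Projections of consecutive corners are joined side by side. The extra `1` pays for two different
projections of the last corner. -/
theorem joined_proj_flatten {δ : ℕ} (hδ : ThinTriangles X H δ) (hc : IsConnected X H)
    {L : List (List (OLetter X H))} (hL : ∀ w ∈ L, IsGeodesicWord w) {f g u v : G}
    (hfg : f * eval L.flatten = g) (hav : Avoids c f L.flatten)
    (hu : u ∈ proj X f c) (hv : v ∈ proj X g c) :
    Joined X c u v ((L.length + 1) * (16 * δ + 9)) := by
  induction L generalizing f u with
  | nil =>
    have hq : IsGeodesic (X := X) (H := H) f g [] := ⟨hfg, fun w _ => by simp⟩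
    simpa using joined_proj hδ hc hq trivial hu hv
  | cons w L ih =>
    rw [List.flatten_cons, avoids_append] at hav
    obtain ⟨x, hx⟩ := proj_nonempty (X := X) (f * eval w) c
    have h1 := joined_proj hδ hc ⟨rfl, hL w (by simp)⟩ hav.1 hu hx
    have h2 := ih (fun w hw => hL w (by simp [hw]))
      (by rw [← hfg]; simp [mul_assoc]) hav.2 hx
    refine (h1.trans h2).mono ?_
    simp only [List.length_cons]
    ring_nf
    omega

/-- A decomposition of a concatenation of lists, all of whose sublists inherit a property. -/
theorem exists_flatten_of_flatten_eq_append {α : Type*} {P : List α → Prop}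
    (hP : ∀ x m y, P (x ++ m ++ y) → P m) {L : List (List α)} (hL : ∀ w ∈ L, P w)
    {p q : List α} (h : L.flatten = p ++ q) :
    ∃ L₁ L₂ : List (List α), L₁.flatten = p ∧ L₂.flatten = q ∧ (∀ w ∈ L₁, P w) ∧
      (∀ w ∈ L₂, P w) ∧ L₁.length + L₂.length ≤ L.length + 1 := by
  induction L generalizing p with
  | nil =>
    obtain ⟨rfl, rfl⟩ : p = [] ∧ q = [] := by simpa using h
    exact ⟨[], [], by simp⟩
  | cons w L ih =>
    have hw : P w := hL w (by simp)
    have hL' : ∀ w ∈ L, P w := fun w hw => hL w (by simp [hw])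
    rw [List.flatten_cons, List.append_eq_append_iff] at h
    rcases h with ⟨a, rfl, h⟩ | ⟨b, rfl, h⟩
    · obtain ⟨L₁, L₂, h1, h2, h3, h4, h5⟩ := ih hL' h
      refine ⟨w :: L₁, L₂, by simp [h1], h2, ?_, h4, by simp; omega⟩
      simpa [hw] using h3
    · refine ⟨[p], b :: L, by simp, by simp [h], ?_, ?_, by simp; omega⟩
      · simpa using hP [] p b (by simpa using hw)
      · simpa using ⟨hP p b [] (by simpa using hw), hL'⟩

/-- The component is the maximal run of `H i`-letters around `s`; such a run stays in one coset. -/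
theorem isPeriph_component {w : List (OLetter X H)} {x y : List (OLetter X H)} {s : OLetter X H}
    (hw : w = x ++ s :: y) (hs : OLetter.IsPeriph i s) (f : G) :
    ∃ b₁ a b₂, w = b₁ ++ a ++ b₂ ∧ IsComponent i b₁ a b₂ ∧
      ((f * eval b₁ : G) : G ⧸ H i) = (f * eval x : G) := by
  classical
  set P : OLetter X H → Bool := fun s => decide (OLetter.IsPeriph i s) with hP
  have hx : x = x.rdropWhile P ++ x.rtakeWhile P := (List.rdropWhile_append_rtakeWhile ..).symm
  have hy : y = y.takeWhile P ++ y.dropWhile P := (List.takeWhile_append_dropWhile ..).symm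
  have hxt : ∀ t ∈ x.rtakeWhile P, OLetter.IsPeriph i t := by
    intro t ht
    simpa [hP] using List.mem_rtakeWhile_imp ht
  refine ⟨x.rdropWhile P, x.rtakeWhile P ++ s :: y.takeWhile P, y.dropWhile P, ?_, ⟨by simp, ?_, ?_,
    ?_⟩, ?_⟩
  · rw [hw]
    conv_lhs => rw [hx, hy]
    simp only [List.append_assoc, List.cons_append]
  · intro t ht
    simp only [List.mem_append, List.mem_cons] at ht
    rcases ht with ht | rfl | ht
    · exact hxt t ht
    · exact hs
    · simpa [hP] using List.mem_takeWhile_imp ht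
  · intro t ht
    have hne : x.rdropWhile P ≠ [] := by rintro h; simp [h] at ht
    rw [List.getLast?_eq_some_getLast hne] at ht
    have := List.rdropWhile_last_not P x hne
    rw [Option.mem_some_iff.1 ht] at this
    simpa [hP] using this
  · intro t ht
    have := List.head?_dropWhile_not P y
    rw [Option.mem_def] at ht
    rw [ht] at this
    simpa [hP] using this
  · conv_rhs => rw [hx]
    rw [eval_append, ← mul_assoc]
    exact (QuotientGroup.mk_mul_of_mem _ (eval_mem hxt)).symm

theorem avoids_of_forall_component {v : G} {b : List (OLetter X H)}
    (h : ∀ b₁ a b₂, b = b₁ ++ a ++ b₂ → IsComponent i b₁ a b₂ →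
      ((v * eval b₁ : G) : G ⧸ H i) ≠ c) : Avoids c v b := by
  by_contra hcon
  obtain ⟨x, s, y, hb, hs, hx⟩ := not_avoids_iff.1 hcon
  obtain ⟨b₁, a, b₂, hb', ha, he⟩ := isPeriph_component hb hs v
  exact h b₁ a b₂ hb' ha (he.trans hx)

/-- The complement `b` of an isolated component is a path from `v` back to `u` without edges in
their coset, and `u`, `v` are their own projections. Cutting the polygon at the start of the cyclic
shift and at the end of the component adds at most one piece each time, so `b` consists of at most
`n + 2` geodesics. -/
theorem isPolygonConstant_of_thinTriangles {δ : ℕ} (hδ : ThinTriangles X H δ)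
    (hc : IsConnected X H) : IsPolygonConstant X H (4 * (16 * δ + 9) : ℕ) := by
  intro f sides hsides hclosed i u v hiso
  obtain ⟨p, q, a, b, hpq, hab, ha0, ha, -, -, hu, hv, hb⟩ := hiso
  have hPinf : ∀ x m y : List (OLetter X H), IsGeodesicWord (x ++ m ++ y) → IsGeodesicWord m :=
    fun x m y h => isGeodesicWord_of_infix h
  have hav : Avoids (u : G ⧸ H i) v b := avoids_of_forall_component hb
  obtain ⟨L₁, L₂, h1, h2, h3, h4, h5⟩ := exists_flatten_of_flatten_eq_append hPinf hsides hpq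
  have h6 : (L₂ ++ L₁).flatten = a ++ b := by rw [List.flatten_append, h1, h2, hab]
  obtain ⟨M₁, M₂, -, m2, -, m4, m5⟩ := exists_flatten_of_flatten_eq_append hPinf
    (by simpa [or_imp, forall_and] using ⟨h4, h3⟩) h6
  have hclosed' : u * eval a * eval b = u := by
    have hqp : eval q * eval p = eval a * eval b := by rw [← eval_append, hab, eval_append]
    rw [hpq, eval_append] at hclosed
    rw [mul_assoc, ← hqp, mul_eq_one_comm.1 hclosed, mul_one]
  have huc : ((v : G) : G ⧸ H i) = u := by
    rw [hv]
    exact QuotientGroup.mk_mul_of_mem _ (eval_mem ha)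
  have hJ := joined_proj_flatten hδ hc m4 (f := v) (g := u) (by rw [m2, hv, hclosed'])
    (m2 ▸ hav) (self_mem_proj huc) (self_mem_proj rfl)
  -- A polygon with a component has a side, and then `(n + 2) + 1 ≤ 4 * n`.
  have hpos : 1 ≤ sides.length := by
    rcases sides with _ | ⟨w, sides⟩
    · obtain ⟨rfl, rfl⟩ : p = [] ∧ q = [] := by simpa using hpq
      simp_all
    · simp
  refine (hJ.symm.relMetric_le rfl huc).trans ?_
  rw [List.length_append] at m5
  have hle : (M₂.length + 1) * (16 * δ + 9) ≤ sides.length * (4 * (16 * δ + 9)) := by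
    rw [← mul_assoc]
    exact Nat.mul_le_mul_right _ (by omega)
  exact_mod_cast hle

/-! ### Penetrated cosets -/

theorem wordDist_le_cosetDist (hc : IsConnected X H) (f g : G) (c : G ⧸ H i) :
    wordDist X H f g ≤ cosetDist X f c + 1 + cosetDist X g c := by
  obtain ⟨u, hu⟩ := proj_nonempty (X := X) f c
  obtain ⟨v, hv⟩ := proj_nonempty (X := X) g c
  have h1 := wordDist_triangle hc f u g
  have h2 := wordDist_triangle hc u v g
  have h3 : wordDist X H u v ≤ 1 := wordDist_le_one (hu.1.trans hv.1.symm)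
  have h4 := hu.2
  have h5 := hv.2
  rw [wordDist_comm hc] at h5
  omega

/-- The parts before and after the edge are at least as long as the distances to `c`, while the
whole geodesic is at most their sum plus 1. Hence equality holds throughout. -/
theorem IsGeodesic.edge_in_coset (hc : IsConnected X H) {f g : G} {x y : List (OLetter X H)}
    {s : OLetter X H} (hw : IsGeodesic f g (x ++ s :: y)) (hs : OLetter.IsPeriph i s)
    (hx : ((f * eval x : G) : G ⧸ H i) = c) :
    x.length = cosetDist X f c ∧ f * eval x ∈ proj X f c ∧ f * eval x * s.val ∈ proj X g c ∧
      wordDist X H f g = cosetDist X f c + 1 + cosetDist X g c := by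
  have hl := ((isGeodesic_iff hc).1 hw).2
  simp only [List.length_append, List.length_cons] at hl
  have hv : ((f * eval x * s.val : G) : G ⧸ H i) = c := (mk_mul_val hs _).trans hx
  have hg : g * eval (RelCayley.invWord y) = f * eval x * s.val := by
    rw [← hw.1]
    simp [mul_assoc]
  have h1 := (cosetDist_le (X := X) (f := f) hx).trans (wordDist_le rfl)
  have h2 := (cosetDist_le (X := X) (f := g) hv).trans (wordDist_le hg)
  rw [length_invWord] at h2
  have h3 := wordDist_le_cosetDist hc f g c
  exact ⟨by omega, mem_proj_of_length_le rfl (by omega) hx,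
    mem_proj_of_length_le hg (by rw [length_invWord]; omega) hv, by omega⟩

theorem Penetrates.exists_edge {f g u v : G} {w : List (OLetter X H)} (hw : IsGeodesic f g w)
    (h : Penetrates i f w c u v) :
    ∃ x s y, w = x ++ s :: y ∧ OLetter.IsPeriph i s ∧ ((f * eval x : G) : G ⧸ H i) = c ∧
      u = f * eval x ∧ v = f * eval x * s.val := by
  obtain ⟨x, a, y, hxy, ha, rfl, rfl, hcc⟩ := h
  have hl := IsGeodesicWord.length_le_one (hxy ▸ hw.2) (eval_mem ha.2.1)
  obtain ⟨s, a, rfl⟩ := List.exists_cons_of_ne_nil ha.1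
  obtain rfl : a = [] := by simpa using hl
  exact ⟨x, s, y, by simpa using hxy, ha.2.1 s (by simp), hcc, rfl, by simp⟩

theorem exists_penetrates {f : G} {w : List (OLetter X H)} (h : ¬ Avoids c f w) :
    ∃ u v, Penetrates i f w c u v := by
  obtain ⟨x, s, y, hb, hs, hx⟩ := not_avoids_iff.1 h
  obtain ⟨b₁, a, b₂, hb', ha, he⟩ := isPeriph_component hb hs f
  exact ⟨_, _, b₁, a, b₂, hb', ha, rfl, rfl, he.trans hx⟩

theorem finite_setOf_not_avoids (i : Λ) (f : G) (w : List (OLetter X H)) :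
    {c : G ⧸ H i | ¬ Avoids c f w}.Finite := by
  refine ((Finset.range (w.length + 1)).finite_toSet.image
    fun n => ((f * eval (w.take n) : G) : G ⧸ H i)).subset ?_
  intro c hcw
  obtain ⟨x, s, y, rfl, -, hx⟩ := not_avoids_iff.1 hcw
  exact ⟨x.length, by simp, by simpa using hx⟩

/-! ### Cosets with distant projections -/

variable (X) in
/-- A geodesic from `f` to `g` runs through the coset `c`, and its entrance and exit points are
at relative distance more than `D`. -/
def IsFar (D : ℝ≥0) (f g : G) (c : G ⧸ H i) : Prop :=
  wordDist X H f g = cosetDist X f c + 1 + cosetDist X g c ∧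
    ∃ u ∈ proj X f c, ∃ v ∈ proj X g c, (D : ℝ≥0∞) < relMetric X H i u v

variable {D : ℝ≥0}

theorem IsFar.symm (hc : IsConnected X H) {f g : G} (h : IsFar X D f g c) : IsFar X D g f c := by
  obtain ⟨h1, u, hu, v, hv, h2⟩ := h
  refine ⟨?_, v, hv, u, hu, by rwa [relMetric_comm]⟩
  rw [wordDist_comm hc, h1]
  omega

theorem isFar_comm (hc : IsConnected X H) {f g : G} : IsFar X D f g c ↔ IsFar X D g f c :=
  ⟨IsFar.symm hc, IsFar.symm hc⟩

theorem isFar_smul_iff (h f g : G) : IsFar X D (h * f) (h * g) (h • c) ↔ IsFar X D f g c := by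
  unfold IsFar
  rw [wordDist_mul_left, cosetDist_mul_left, cosetDist_mul_left]
  refine and_congr_right fun _ => ⟨?_, ?_⟩
  · rintro ⟨u, hu, v, hv, huv⟩
    refine ⟨h⁻¹ * u, ?_, h⁻¹ * v, ?_, by rwa [relMetric_mul_left]⟩
    · rw [← mul_mem_proj_iff h]; simpa using hu
    · rw [← mul_mem_proj_iff h]; simpa using hv
  · rintro ⟨u, hu, v, hv, huv⟩
    exact ⟨h * u, (mul_mem_proj_iff ..).2 hu, h * v, (mul_mem_proj_iff ..).2 hv,
      by rwa [relMetric_mul_left]⟩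

theorem IsSeparating.isFar (hc : IsConnected X H) {f g : G} (h : IsSeparating X H i D f g c) :
    IsFar X D f g c := by
  obtain ⟨w, hw, u, v, hp, hD⟩ := h
  obtain ⟨x, s, y, rfl, hs, hx, rfl, rfl⟩ := hp.exists_edge hw
  obtain ⟨-, h2, h3, h4⟩ := hw.edge_in_coset hc hs hx
  exact ⟨h4, _, h2, _, h3, hD⟩

/-- A geodesic from `f` to `k` through the edge from `u` to `v` forms a triangle with `γ` and `σ`.
If both of these avoid `c`, that edge is an isolated component, so its relative length is at most `3
* C ≤ D`, contrary to farness. -/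
theorem IsFar.not_avoids_or (hc : IsConnected X H) {C : ℝ≥0} (hC : IsPolygonConstant X H C)
    (hD : 3 * C ≤ D) {f g k : G} (h : IsFar X D f k c) {γ σ : List (OLetter X H)}
    (hγ : IsGeodesic f g γ) (hσ : IsGeodesic g k σ) : ¬ Avoids c f γ ∨ ¬ Avoids c g σ := by
  by_contra! hcon
  obtain ⟨hγa, hσa⟩ := hcon
  obtain ⟨hfk, u, hu, v, hv, huv⟩ := h
  have hne : u⁻¹ * v ≠ 1 := by
    intro e
    rw [inv_mul_eq_one.1 e, relMetric_self] at huv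
    simp at huv
  obtain ⟨s, hs, hse⟩ := exists_periph_letter (X := X)
    (QuotientGroup.eq.1 (hu.1.trans hv.1.symm)) hne
  obtain ⟨x, hx, hxl⟩ := exists_word_of_mem_proj hc hu
  obtain ⟨y, hy, hyl⟩ := exists_word_of_mem_proj hc hv
  have hxa : Avoids c f x := avoids_of_length_le hxl.le
  have hya : Avoids c v (invWord y) :=
    (avoids_of_length_le (f := k) hyl.le : Avoids c k y).invWord' hy.1
  have huse : u * s.val = v := by rw [hse]; group
  have hend : v * eval (invWord y) = k := by rw [← hy.1]; simp
  -- The distance equation in `IsFar` is exactly what makes this concatenation geodesic.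
  have hw : IsGeodesic f k (x ++ s :: invWord y) := by
    rw [isGeodesic_iff hc]
    refine ⟨?_, ?_⟩
    · rw [eval_append, eval_cons, ← mul_assoc, ← mul_assoc, hx.1, huse, hend]
    · simp [hfk, hxl, hyl]
      omega
  have hσ' := hσa.invWord' hσ.1
  have hγ' := hγa.invWord' hγ.1
  have hσe : k * eval (invWord σ) = g := hσ.invWord.1
  have hγe : g * eval (invWord γ) = f := hγ.invWord.1
  -- The rest of the triangle, read cyclically from the end of the edge.
  set b := invWord y ++ invWord σ ++ invWord γ ++ x with hb
  have hba : Avoids c v b := by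
    rw [hb]
    simp only [avoids_append, eval_append]
    refine ⟨⟨⟨hya, ?_⟩, ?_⟩, ?_⟩
    · rwa [hend]
    · rwa [← mul_assoc, hend, hσe]
    · rwa [← mul_assoc, ← mul_assoc, hend, hσe, hγe]
  have hbe : v * eval b = u := by
    rw [hb]
    simp only [eval_append]
    rw [← mul_assoc, ← mul_assoc, ← mul_assoc, hend, hσe, hγe, hx.1]
  have hpoly := hC f [x ++ s :: invWord y, invWord σ, invWord γ] ?_ ?_ i u v ?_
  · refine (huv.trans_le hpoly).not_ge ?_
    have : ((3 * C : ℝ≥0) : ℝ≥0∞) ≤ D := by exact_mod_cast hD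
    simpa using this
  · simp only [List.mem_cons, List.not_mem_nil, or_false]
    rintro w (rfl | rfl | rfl)
    exacts [hw.2, hσ.invWord.2, hγ.invWord.2]
  · have : f * eval (x ++ s :: invWord y) * eval (invWord σ) * eval (invWord γ) = f := by
      rw [hw.1, hσe, hγe]
    simpa [mul_assoc] using this
  · refine ⟨x, s :: invWord y ++ invWord σ ++ invWord γ, [s], b, by simp, by simp [hb], by simp,
      by simpa using hs, ?_, ?_, hx.1.symm, by simp [huse], ?_⟩
    · intro t ht hper
      obtain ⟨b', hb'⟩ := List.head?_eq_some_iff.1 ht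
      refine not_avoids_iff.2 ⟨[], t, b', hb', hper, ?_⟩ hba
      simpa using hv.1
    · intro t ht hper
      obtain ⟨b', hb'⟩ := List.getLast?_eq_some_iff.1 ht
      refine not_avoids_iff.2 ⟨b', t, [], hb', hper, ?_⟩ hba
      rw [← hu.1, ← hbe, hb', eval_append, ← mul_assoc]
      simpa using (mk_mul_val hper (v * eval b')).symm
    · rintro b₁ a b₂ hbb ha hcos
      obtain ⟨t, a', rfl⟩ := List.exists_cons_of_ne_nil ha.1
      exact not_avoids_iff.2 ⟨b₁, t, a' ++ b₂, by simpa using hbb, ha.2.1 t (by simp),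
        hcos.trans hu.1⟩ hba

variable (X) in
/-- Every geodesic from `f` to `g` has an edge in the coset `c`. -/
def Meets (f g : G) (c : G ⧸ H i) : Prop :=
  ∀ w : List (OLetter X H), IsGeodesic f g w → ¬ Avoids c f w

theorem IsFar.meets (hc : IsConnected X H) {C : ℝ≥0} (hC : IsPolygonConstant X H C)
    (hD : 3 * C ≤ D) {f k : G} (h : IsFar X D f k c) : Meets X f k c := by
  intro w hw
  -- A degenerate triangle, with the constant path at `f` as one side.
  have h0 : IsGeodesic (X := X) (H := H) f f [] := ⟨by simp, fun w _ => by simp⟩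
  exact (h.not_avoids_or hc hC hD h0 hw).resolve_left (by simp)

theorem IsFar.meets_of_avoids (hc : IsConnected X H) {C : ℝ≥0} (hC : IsPolygonConstant X H C)
    (hD : 3 * C ≤ D) {f g k : G} (h : IsFar X D f k c) {γ : List (OLetter X H)}
    (hγ : IsGeodesic f g γ) (hγa : Avoids c f γ) : Meets X g k c :=
  fun _ hσ => (h.not_avoids_or hc hC hD hγ hσ).resolve_left (by simpa using hγa)

theorem Meets.wordDist_eq (hc : IsConnected X H) {f k : G} (h : Meets X f k c) :
    wordDist X H f k = cosetDist X f c + 1 + cosetDist X k c := by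
  obtain ⟨w, hw⟩ := exists_isGeodesic hc f k
  obtain ⟨x, s, y, rfl, hs, hx⟩ := not_avoids_iff.1 (h w hw)
  exact (hw.edge_in_coset hc hs hx).2.2.2

/-- On a fixed geodesic from `f` to `k`, the distance of the coset from `k` determines the position
of its edge. -/
theorem Meets.eq_of_cosetDist_eq (hc : IsConnected X H) {f k : G} {c' : G ⧸ H i}
    (h : Meets X f k c) (h' : Meets X f k c') (heq : cosetDist X k c = cosetDist X k c') :
    c = c' := by
  obtain ⟨w, hw⟩ := exists_isGeodesic hc f k
  obtain ⟨x, s, y, hxy, hs, hx⟩ := not_avoids_iff.1 (h w hw)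
  obtain ⟨x', s', y', hxy', hs', hx'⟩ := not_avoids_iff.1 (h' w hw)
  have h1 := (IsGeodesic.edge_in_coset hc (hxy ▸ hw) hs hx).1
  have h2 := (IsGeodesic.edge_in_coset hc (hxy' ▸ hw) hs' hx').1
  have h3 := h.wordDist_eq hc
  have h4 := h'.wordDist_eq hc
  have h5 : x = x' := (List.append_inj (hxy.symm.trans hxy') (by omega)).1
  rw [← hx, ← hx', h5]

/-- The projections to a coset of two points that are both separated from it by another coset
coincide. -/
theorem proj_subset_of_meets (hc : IsConnected X H) {f g k : G} {c' : G ⧸ H i}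
    (hf : Meets X f k c) (hf' : Meets X f k c') (hg : Meets X g k c) (hg' : Meets X g k c')
    (hlt : cosetDist X k c < cosetDist X k c') : proj X f c ⊆ proj X g c := by
  intro u hu
  have e1 := hf.wordDist_eq hc
  have e2 := hf'.wordDist_eq hc
  have e3 := hg.wordDist_eq hc
  have e4 := hg'.wordDist_eq hc
  refine ⟨hu.1, le_antisymm ?_ (cosetDist_le hu.1)⟩
  obtain ⟨s, hs, hsl⟩ := exists_word_of_mem_proj hc hu
  obtain ⟨m, hm⟩ := exists_isGeodesic hc u k
  have hml := ((isGeodesic_iff hc).1 hm).2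
  have huk : wordDist X H u k ≤ 1 + cosetDist X k c := by
    have := wordDist_le_cosetDist hc u k c
    have h0 := cosetDist_le (X := X) (f := u) hu.1
    rw [wordDist_self] at h0
    omega
  have hsm : f * eval (s ++ m) = k := by rw [eval_append, ← mul_assoc, hs.1, hm.1]
  -- The nearest point `u` lies on a geodesic from `f` to `k`, which must also have an edge in `c'`.
  have hw : IsGeodesic f k (s ++ m) := by
    refine (isGeodesic_iff hc).2 ⟨hsm, le_antisymm ?_ (wordDist_le hsm)⟩
    rw [List.length_append]
    omega
  by_cases hsa : Avoids c' f s
  -- An edge in `c'` after `u` is impossible: `c'` is farther from `k` than `c`, hence closer to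
  -- `f`.
  · have hma : ¬ Avoids c' u m := by
      intro hma
      refine hf' _ hw (avoids_append.2 ⟨hsa, ?_⟩)
      rwa [hs.1]
    obtain ⟨x, t, y, rfl, ht, hx⟩ := not_avoids_iff.1 hma
    rw [← List.append_assoc] at hw
    have hx' : ((f * eval (s ++ x) : G) : G ⧸ H i) = c' := by
      rwa [eval_append, ← mul_assoc, hs.1]
    have h1 := (IsGeodesic.edge_in_coset hc hw ht hx').1
    rw [List.length_append] at h1
    omega
  -- The path from `f` to `u` passes through `c'`. Going from `g` to `c'`, across it by at most one
  -- edge and then along `y` reaches `u` within `cosetDist X g c` steps.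
  · obtain ⟨x, t, y, rfl, ht, hx⟩ := not_avoids_iff.1 hsa
    have hx0 : x.length = cosetDist X f c' :=
      (IsGeodesic.edge_in_coset hc hs ht hx).1
    have hyu : f * eval x * t.val * eval y = u := by
      rw [← hs.1]
      simp [mul_assoc]
    have h1 : wordDist X H (f * eval x * t.val) u ≤ y.length := wordDist_le hyu
    have hv : ((f * eval x * t.val : G) : G ⧸ H i) = c' := (mk_mul_val ht _).trans hx
    obtain ⟨z, hz⟩ := proj_nonempty (X := X) g c'
    have h2 := wordDist_triangle hc g z u
    have h3 := wordDist_triangle hc z (f * eval x * t.val) u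
    have h4 : wordDist X H z (f * eval x * t.val) ≤ 1 := wordDist_le_one (hz.1.trans hv.symm)
    have h5 := hz.2
    simp only [List.length_append, List.length_cons] at hsl
    omega

theorem proj_eq_of_meets (hc : IsConnected X H) {f g k : G} {c' : G ⧸ H i}
    (hf : Meets X f k c) (hf' : Meets X f k c') (hg : Meets X g k c) (hg' : Meets X g k c')
    (hlt : cosetDist X k c < cosetDist X k c') : proj X f c = proj X g c :=
  (proj_subset_of_meets hc hf hf' hg hg' hlt).antisymm
    (proj_subset_of_meets hc hg hg' hf hf' hlt)

/-- With at most one exception, a coset that is avoided by a geodesic `γ` from `f` to `g` and that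
is far between `f` and `k` or between `g` and `k` is seen from `f` and `g` in the same way. -/
theorem exists_forall_proj_eq (hc : IsConnected X H) {C : ℝ≥0} (hC : IsPolygonConstant X H C)
    (hD : 3 * C ≤ D) (i : Λ) {f g : G} {γ : List (OLetter X H)} (hγ : IsGeodesic f g γ) (k : G) :
    ∃ c' : G ⧸ H i, ∀ c : G ⧸ H i, Avoids c f γ → c ≠ c' →
      IsFar X D f k c ∨ IsFar X D g k c →
        proj X f c = proj X g c ∧ (IsFar X D f k c ↔ IsFar X D g k c) := by
  set T : Set (G ⧸ H i) := {c | Avoids c f γ ∧ (IsFar X D f k c ∨ IsFar X D g k c)} with hT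
  have hmeets : ∀ c ∈ T, Meets X f k c ∧ Meets X g k c := by
    rintro c ⟨hav, h | h⟩
    · exact ⟨h.meets hc hC hD, h.meets_of_avoids hc hC hD hγ hav⟩
    · exact ⟨h.meets_of_avoids hc hC hD hγ.invWord (hav.invWord' hγ.1), h.meets hc hC hD⟩
  rcases T.eq_empty_or_nonempty with hTe | hTn
  -- No coset is in question here, so the exception is arbitrary.
  · refine ⟨((1 : G) : G ⧸ H i), fun c hav _ hfar => ?_⟩
    have : c ∈ T := ⟨hav, hfar⟩
    simp [hTe] at this
  · have hbdd : BddAbove ((fun c => cosetDist X k c) '' T) := by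
      refine ⟨wordDist X H f k, ?_⟩
      rintro _ ⟨c, hcT, rfl⟩
      have := (hmeets c hcT).1.wordDist_eq hc
      simp only
      omega
    -- The exception is a coset of `T` at the greatest distance from `k`; all distances are bounded
    -- by that from `f` to `k`.
    obtain ⟨c', hc'T, hc'⟩ := Nat.sSup_mem (hTn.image _) hbdd
    refine ⟨c', fun c hav hne hfar => ?_⟩
    have hcT : c ∈ T := ⟨hav, hfar⟩
    have hle : cosetDist X k c ≤ cosetDist X k c' := (le_csSup hbdd ⟨c, hcT, rfl⟩).trans_eq hc'.symm
    obtain ⟨m1, m2⟩ := hmeets c hcT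
    obtain ⟨m3, m4⟩ := hmeets c' hc'T
    have hlt : cosetDist X k c < cosetDist X k c' :=
      lt_of_le_of_ne hle fun e => hne (m1.eq_of_cosetDist_eq hc m3 e)
    have hp := proj_eq_of_meets hc m1 m3 m2 m4 hlt
    refine ⟨hp, ?_⟩
    unfold IsFar
    rw [hp, m1.wordDist_eq hc, m2.wordDist_eq hc]
    simp

/-! ### Relative distances between projections, and finiteness. -/

theorem relMetric_le_of_avoids {δ : ℕ} (hδ : ThinTriangles X H δ) (hc : IsConnected X H)
    {f g u v : G} {q : List (OLetter X H)} (hq : IsGeodesic f g q) (hav : Avoids c f q)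
    (hu : u ∈ proj X f c) (hv : v ∈ proj X g c) :
    relMetric X H i u v ≤ (16 * δ + 9 : ℕ) :=
  (joined_proj hδ hc hq hav hu hv).relMetric_le hu.1 hv.1

theorem relMetric_le_of_mem_proj {δ : ℕ} (hδ : ThinTriangles X H δ) (hc : IsConnected X H)
    {f u v : G} (hu : u ∈ proj X f c) (hv : v ∈ proj X f c) :
    relMetric X H i u v ≤ (16 * δ + 9 : ℕ) :=
  relMetric_le_of_avoids hδ hc (q := []) ⟨by simp, fun w _ => by simp⟩ trivial hu hv

/-- Either the distance equation holds and all pairs of projections are within `D`, or it fails and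
geodesics from `f` to `g` have no edge in `c`. -/
theorem relMetric_le_of_not_isFar {δ : ℕ} (hδ : ThinTriangles X H δ) (hc : IsConnected X H)
    {f g u v : G} (h : ¬ IsFar X D f g c) (hu : u ∈ proj X f c) (hv : v ∈ proj X g c) :
    relMetric X H i u v ≤ max (D : ℝ≥0∞) (16 * δ + 9 : ℕ) := by
  by_cases h1 : wordDist X H f g = cosetDist X f c + 1 + cosetDist X g c
  · refine le_max_of_le_left (not_lt.1 fun h2 => h ⟨h1, u, hu, v, hv, h2⟩)
  · refine le_max_of_le_right ?_
    obtain ⟨w, hw⟩ := exists_isGeodesic hc f g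
    refine relMetric_le_of_avoids hδ hc hw ?_ hu hv
    by_contra hav
    obtain ⟨x, s, y, rfl, hs, hx⟩ := not_avoids_iff.1 hav
    exact h1 (hw.edge_in_coset hc hs hx).2.2.2

/-- Two projections of one point are at bounded relative distance, so local finiteness applies. -/
theorem finite_proj (hH : IsHypEmbedded X H) (f : G) (c : G ⧸ H i) : (proj X f c).Finite := by
  obtain ⟨δ, hδ⟩ := hH.hyperbolic
  have hc := isConnected_of_closure hH.generates
  obtain ⟨u, hu⟩ := proj_nonempty (X := X) f c
  refine ((hH.locallyFinite i (16 * δ + 9)).image fun h => u * h).subset ?_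
  intro v hv
  refine ⟨u⁻¹ * v, ⟨QuotientGroup.eq.1 (hu.1.trans hv.1.symm), ?_⟩, by simp⟩
  rw [← relMetric_eq_one_left]
  exact relMetric_le_of_mem_proj hδ hc hu hv

theorem finite_setOf_isFar (hc : IsConnected X H) {C : ℝ≥0} (hC : IsPolygonConstant X H C)
    (hD : 3 * C ≤ D) (i : Λ) (f g : G) : {c : G ⧸ H i | IsFar X D f g c}.Finite := by
  obtain ⟨w, hw⟩ := exists_isGeodesic hc f g
  exact (finite_setOf_not_avoids i f w).subset fun c hcf => IsFar.meets hc hC hD hcf w hw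

end RelCayley

/-! ### Square summable functions on a subgroup -/

theorem EllTwo.norm_le_of_apply_le {S : Type*} {ξ η : EllTwo S}
    (h : ∀ x, ‖(ξ : S → ℂ) x‖ ≤ ‖(η : S → ℂ) x‖) : ‖ξ‖ ≤ ‖η‖ := by
  refine lp.norm_le_of_tsum_le (by norm_num) (norm_nonneg _) ?_
  rw [lp.norm_rpow_eq_tsum (by norm_num) η]
  have hs : ∀ ζ : EllTwo S, Summable fun x => ‖(ζ : S → ℂ) x‖ ^ (2 : ℝ≥0∞).toReal :=
    fun ζ => (lp.memℓp ζ).summable (by norm_num)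
  exact (hs ξ).tsum_le_tsum (fun x => Real.rpow_le_rpow (norm_nonneg _) (h x) (by norm_num)) (hs η)

section Extension

variable {G : Type*} [Group G]

open Classical in
/-- Extension by zero of a function on a subgroup. -/
def zeroExtend (K : Subgroup G) (ξ : K → ℂ) (x : G) : ℂ := if h : x ∈ K then ξ ⟨x, h⟩ else 0

@[simp] theorem zeroExtend_coe (K : Subgroup G) (ξ : K → ℂ) (x : K) :
    zeroExtend K ξ x = ξ x := by simp [zeroExtend]

theorem zeroExtend_of_notMem {K : Subgroup G} (ξ : K → ℂ) {x : G} (hx : x ∉ K) :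
    zeroExtend K ξ x = 0 := by simp [zeroExtend, hx]

theorem memℓp_zeroExtend (K : Subgroup G) (ξ : EllTwo K) : Memℓp (zeroExtend K ξ) 2 := by
  have h := lp.memℓp ξ
  rw [memℓp_gen_iff (by norm_num)] at h ⊢
  have hinj : Function.Injective (fun x : K => (x : G)) := Subtype.val_injective
  refine (hinj.summable_iff (f := fun x : G => ‖zeroExtend K ξ x‖ ^ _) ?_).1 ?_
  · intro x hx
    have hxK : x ∉ K := fun h => hx ⟨⟨x, h⟩, rfl⟩
    simp [zeroExtend_of_notMem _ hxK]
  · simpa [Function.comp_def] using h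

/-- Extension by zero of a square summable function on a subgroup. -/
def ellTwoExtend (K : Subgroup G) (ξ : EllTwo K) : EllTwo G := ⟨zeroExtend K ξ, memℓp_zeroExtend K ξ⟩

@[simp] theorem ellTwoExtend_apply (K : Subgroup G) (ξ : EllTwo K) (x : G) :
    (ellTwoExtend K ξ : G → ℂ) x = zeroExtend K ξ x := rfl

theorem norm_ellTwoExtend (K : Subgroup G) (ξ : EllTwo K) : ‖ellTwoExtend K ξ‖ = ‖ξ‖ := by
  rw [lp.norm_eq_tsum_rpow (by norm_num), lp.norm_eq_tsum_rpow (by norm_num)]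
  congr 1
  have hinj : Function.Injective (fun x : K => (x : G)) := Subtype.val_injective
  rw [← hinj.tsum_eq
    (f := fun x : G => ‖(ellTwoExtend K ξ : G → ℂ) x‖ ^ (2 : ℝ≥0∞).toReal)]
  · simp
  · intro x hx
    by_contra hxr
    have hxK : x ∉ K := fun h => hxr ⟨⟨x, h⟩, rfl⟩
    simp [zeroExtend_of_notMem _ hxK] at hx

theorem ellTwoExtend_sub (K : Subgroup G) (ξ η : EllTwo K) :
    ellTwoExtend K (ξ - η) = ellTwoExtend K ξ - ellTwoExtend K η := by
  ext x
  by_cases hx : x ∈ K <;> simp [zeroExtend, hx]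

theorem ellTwoExtend_neg (K : Subgroup G) (ξ : EllTwo K) :
    ellTwoExtend K (-ξ) = -ellTwoExtend K ξ := by
  ext x
  by_cases hx : x ∈ K <;> simp [zeroExtend, hx]

@[simp] theorem leftRegular_apply (g : G) (ξ : EllTwo G) (x : G) :
    (leftRegular G g ξ : G → ℂ) x = (ξ : G → ℂ) (g⁻¹ * x) := rfl

theorem ellTwoExtend_leftRegular (K : Subgroup G) (h : K) (ξ : EllTwo K) :
    ellTwoExtend K (leftRegular K h ξ) = leftRegular G h (ellTwoExtend K ξ) := by
  ext x
  have hx : (h : G)⁻¹ * x ∈ K ↔ x ∈ K := K.mul_mem_cancel_left (K.inv_mem h.2)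
  by_cases hxK : x ∈ K
  · have := zeroExtend_coe K ξ (h⁻¹ * ⟨x, hxK⟩)
    simp only [Subgroup.coe_mul, Subgroup.coe_inv] at this
    rw [leftRegular_apply, ellTwoExtend_apply, ellTwoExtend_apply, this]
    exact zeroExtend_coe K (leftRegular K h ξ : EllTwo K) ⟨x, hxK⟩
  · rw [leftRegular_apply, ellTwoExtend_apply, ellTwoExtend_apply, zeroExtend_of_notMem _ hxK,
      zeroExtend_of_notMem _ (hx.not.2 hxK)]

theorem leftRegular_mul_apply (g h : G) (ξ : EllTwo G) :
    leftRegular G g (leftRegular G h ξ) = leftRegular G (g * h) ξ := by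
  rw [map_mul]; rfl

/-! ### Transporting an array to pairs of points of a coset -/

variable {K : Subgroup G}

open Classical in
/-- The vector `r (u⁻¹ v)` translated to the coset of `u`. -/
def pairVec (r : K → EllTwo K) (u v : G) : EllTwo G :=
  if h : u⁻¹ * v ∈ K then leftRegular G u (ellTwoExtend K (r ⟨u⁻¹ * v, h⟩)) else 0

variable {r : K → EllTwo K}

theorem pairVec_of_mem {u v : G} (h : u⁻¹ * v ∈ K) :
    pairVec r u v = leftRegular G u (ellTwoExtend K (r ⟨u⁻¹ * v, h⟩)) := dif_pos h

theorem norm_pairVec {u v : G} (h : u⁻¹ * v ∈ K) : ‖pairVec r u v‖ = ‖r ⟨u⁻¹ * v, h⟩‖ := by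
  rw [pairVec_of_mem h, LinearIsometryEquiv.norm_map, norm_ellTwoExtend]

theorem pairVec_mul_left (g u v : G) :
    pairVec r (g * u) (g * v) = leftRegular G g (pairVec r u v) := by
  have he : (g * u)⁻¹ * (g * v) = u⁻¹ * v := by group
  by_cases h : u⁻¹ * v ∈ K
  · rw [pairVec_of_mem h, pairVec_of_mem (he.symm ▸ h), leftRegular_mul_apply]
    simp only [he]
  · simp [pairVec, h]

theorem pairVec_apply_of_ne {u v x : G} (h : (x : G ⧸ K) ≠ u) :
    (pairVec r u v : G → ℂ) x = 0 := by
  by_cases huv : u⁻¹ * v ∈ K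
  · rw [pairVec_of_mem huv, leftRegular_apply, ellTwoExtend_apply]
    exact zeroExtend_of_notMem _ fun hx => h (QuotientGroup.eq.2 hx).symm
  · simp [pairVec, huv]

/-- This is the antisymmetry of `r` at `h = u⁻¹ v`, translated by `u`, since `u h = v`. -/
theorem pairVec_swap (hr : IsArray (leftRegular K) r) (u v : G) :
    pairVec r v u = -pairVec r u v := by
  have hinv : (u⁻¹ * v)⁻¹ = v⁻¹ * u := by group
  by_cases h : u⁻¹ * v ∈ K
  · have h' : v⁻¹ * u ∈ K := hinv ▸ K.inv_mem h
    have ha := hr.antisymm ⟨u⁻¹ * v, h⟩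
    have he : (⟨u⁻¹ * v, h⟩ : K)⁻¹ = ⟨v⁻¹ * u, h'⟩ := Subtype.ext hinv
    rw [he] at ha
    rw [pairVec_of_mem h, pairVec_of_mem h', ← neg_eq_iff_eq_neg.2 ha, ellTwoExtend_neg,
      ellTwoExtend_leftRegular, map_neg, neg_neg, leftRegular_mul_apply]
    simp
  · have h' : v⁻¹ * u ∉ K := fun h' => h (by simpa using K.inv_mem h')
    simp [pairVec, h, h']

/-- Moving one point within a coset changes the vector by an amount that depends only on the
displacement. -/
theorem exists_norm_pairVec_sub_le (hr : IsArray (leftRegular K) r) :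
    ∃ β : G → ℝ, ∀ u u' w : G, (u : G ⧸ K) = u' → (w : G ⧸ K) = u →
      ‖pairVec r u w - pairVec r u' w‖ ≤ β (u⁻¹ * u') ∧
        ‖pairVec r w u - pairVec r w u'‖ ≤ β (u⁻¹ * u') := by
  classical
  choose b hb using hr.bounded
  have hb' : ∀ g h : K, ‖r (g * h) - leftRegular K g (r h)‖ ≤ b g := fun g h => hb g ⟨h, rfl⟩
  -- The default value is never used, as the displacement lies in `K`.
  refine ⟨fun h => if hh : h ∈ K then b ⟨h, hh⟩ else 0, fun u u' w hu hw => ?_⟩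
  have h1 : u⁻¹ * u' ∈ K := QuotientGroup.eq.1 hu
  have h2 : u⁻¹ * w ∈ K := QuotientGroup.eq.1 hw.symm
  have h3 : u'⁻¹ * w ∈ K := QuotientGroup.eq.1 (hu.symm.trans hw.symm)
  have key : ‖pairVec r u w - pairVec r u' w‖ ≤ b ⟨u⁻¹ * u', h1⟩ := by
    have he : (⟨u⁻¹ * w, h2⟩ : K) = ⟨u⁻¹ * u', h1⟩ * ⟨u'⁻¹ * w, h3⟩ :=
      Subtype.ext (by simp [mul_assoc])
    have hu' : pairVec r u' w =
        leftRegular G u (ellTwoExtend K (leftRegular K ⟨u⁻¹ * u', h1⟩ (r ⟨u'⁻¹ * w, h3⟩))) := by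
      rw [ellTwoExtend_leftRegular, leftRegular_mul_apply, pairVec_of_mem h3]
      simp
    rw [hu', pairVec_of_mem h2, ← map_sub, ← ellTwoExtend_sub, LinearIsometryEquiv.norm_map,
      norm_ellTwoExtend, he]
    exact hb' _ _
  simp only [dif_pos h1]
  refine ⟨key, ?_⟩
  rw [pairVec_swap hr u w, pairVec_swap hr u' w, neg_sub_neg, norm_sub_rev]
  exact key

/-- The average of the vectors of all pairs in `A × B`. -/
def pairAvg (r : K → EllTwo K) (A B : Set G) : EllTwo G :=
  ((A ×ˢ B).ncard : ℂ)⁻¹ • ∑ᶠ p ∈ A ×ˢ B, pairVec r p.1 p.2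

variable {A B : Set G}

theorem norm_pairAvg_sub_le (hA : A.Finite) (hB : B.Finite) (hA0 : A.Nonempty) (hB0 : B.Nonempty)
    {z : EllTwo G} {M : ℝ} (h : ∀ u ∈ A, ∀ v ∈ B, ‖pairVec r u v - z‖ ≤ M) :
    ‖pairAvg r A B - z‖ ≤ M := by
  have hfin := hA.prod hB
  have hn : ((A ×ˢ B).ncard : ℂ) ≠ 0 := by
    exact_mod_cast (Set.ncard_pos hfin).2 (hA0.prod hB0) |>.ne'
  have hz : z = ((A ×ˢ B).ncard : ℂ)⁻¹ • ∑ p ∈ hfin.toFinset, z := by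
    rw [Finset.sum_const, ← Set.ncard_eq_toFinset_card _ hfin, ← Nat.cast_smul_eq_nsmul ℂ,
      smul_smul, inv_mul_cancel₀ hn, one_smul]
  rw [pairAvg, finsum_mem_eq_finite_toFinset_sum _ hfin]
  conv_lhs => rw [hz]
  rw [← smul_sub, ← Finset.sum_sub_distrib, norm_smul, norm_inv, Complex.norm_natCast,
    inv_mul_le_iff₀ (by exact_mod_cast Nat.pos_of_ne_zero (by exact_mod_cast hn))]
  refine (norm_sum_le_of_le _ (f := fun p : G × G => pairVec r p.1 p.2 - z) (n := fun _ => M)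
    fun p hp => ?_).trans ?_
  · have hp' : p ∈ A ×ˢ B := by simpa using hp
    exact h _ hp'.1 _ hp'.2
  · rw [Finset.sum_const, nsmul_eq_mul, Set.ncard_eq_toFinset_card _ hfin]

theorem pairAvg_image_mul_left (hA : A.Finite) (hB : B.Finite) (g : G) :
    pairAvg r ((fun u => g * u) '' A) ((fun u => g * u) '' B) =
      leftRegular G g (pairAvg r A B) := by
  have hinj : Function.Injective (Prod.map (fun u => g * u) (fun u : G => g * u)) :=
    (mul_right_injective g).prodMap (mul_right_injective g)
  rw [pairAvg, pairAvg, Set.prod_image_image_eq]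
  change ((Prod.map (fun u => g * u) (fun u : G => g * u) '' A ×ˢ B).ncard : ℂ)⁻¹ •
    ∑ᶠ p ∈ Prod.map (fun u => g * u) (fun u : G => g * u) '' A ×ˢ B, pairVec r p.1 p.2 = _
  rw [Set.ncard_image_of_injective _ hinj, finsum_mem_image hinj.injOn, map_smul]
  congr 1
  rw [finsum_mem_eq_finite_toFinset_sum _ (hA.prod hB),
    finsum_mem_eq_finite_toFinset_sum _ (hA.prod hB), map_sum]
  exact Finset.sum_congr rfl fun p _ => pairVec_mul_left g p.1 p.2

theorem pairAvg_swap (hr : IsArray (leftRegular K) r) (hA : A.Finite) (hB : B.Finite) :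
    pairAvg r B A = -pairAvg r A B := by
  rw [pairAvg, pairAvg, ← Set.image_swap_prod A B,
    Set.ncard_image_of_injective _ Prod.swap_injective,
    finsum_mem_image Prod.swap_injective.injOn, ← smul_neg]
  congr 1
  rw [finsum_mem_eq_finite_toFinset_sum _ (hA.prod hB),
    finsum_mem_eq_finite_toFinset_sum _ (hA.prod hB), ← Finset.sum_neg_distrib]
  exact Finset.sum_congr rfl fun p _ => pairVec_swap hr p.1 p.2

theorem pairAvg_apply_of_ne (hA : A.Finite) (hB : B.Finite) {c : G ⧸ K}
    (hAc : ∀ u ∈ A, (u : G ⧸ K) = c) {x : G} (hx : (x : G ⧸ K) ≠ c) :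
    (pairAvg r A B : G → ℂ) x = 0 := by
  rw [pairAvg, finsum_mem_eq_finite_toFinset_sum _ (hA.prod hB), lp.coeFn_smul, Pi.smul_apply,
    lp.coeFn_sum, Finset.sum_apply, Finset.sum_eq_zero, smul_zero]
  intro p hp
  have hp' : p ∈ A ×ˢ B := by simpa using hp
  exact pairVec_apply_of_ne (by rwa [hAc _ hp'.1])

end Extension

namespace RelCayley

variable {G : Type*} [Group G] {Λ : Type*} {X : Set G} {H : Λ → Subgroup G}
variable {μ : Λ} {c : G ⧸ H μ} {D : ℝ≥0} {r : H μ → EllTwo (H μ)}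

/-! ### The induced array -/

theorem proj_mul_left (h f : G) (c : G ⧸ H μ) :
    proj X (h * f) (h • c) = (fun u => h * u) '' proj X f c := by
  ext u
  constructor
  · intro hu
    refine ⟨h⁻¹ * u, ?_, by simp⟩
    rw [← mul_mem_proj_iff h]
    simpa using hu
  · rintro ⟨u, hu, rfl⟩
    exact (mul_mem_proj_iff ..).2 hu

variable (X) in
open Classical in
/-- The contribution of the coset `c` to the induced array. -/
def farTerm (D : ℝ≥0) (r : H μ → EllTwo (H μ)) (f g : G) (c : G ⧸ H μ) : EllTwo G :=
  if IsFar X D f g c then pairAvg r (proj X f c) (proj X g c) else 0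

variable (X) in
/-- The sum over all far cosets of the averages of the translates of `r`. -/
def farSum (D : ℝ≥0) (r : H μ → EllTwo (H μ)) (f g : G) : EllTwo G :=
  ∑ᶠ c : G ⧸ H μ, farTerm X D r f g c

theorem farTerm_of_isFar {f g : G} (h : IsFar X D f g c) :
    farTerm X D r f g c = pairAvg r (proj X f c) (proj X g c) := if_pos h

theorem farTerm_of_not_isFar {f g : G} (h : ¬ IsFar X D f g c) :
    farTerm X D r f g c = 0 := if_neg h

theorem support_farTerm_subset (r : H μ → EllTwo (H μ)) (f g : G) :
    Function.support (farTerm X D r f g) ⊆ {c | IsFar X D f g c} := by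
  intro c hcs
  by_contra hf
  exact hcs (farTerm_of_not_isFar hf)

theorem farTerm_mul_left (hH : IsHypEmbedded X H) (h f g : G) (c : G ⧸ H μ) :
    farTerm X D r (h * f) (h * g) (h • c) = leftRegular G h (farTerm X D r f g c) := by
  by_cases hf : IsFar X D f g c
  · rw [farTerm_of_isFar hf, farTerm_of_isFar ((isFar_smul_iff ..).2 hf), proj_mul_left,
      proj_mul_left, pairAvg_image_mul_left (finite_proj hH f c) (finite_proj hH g c)]
  · rw [farTerm_of_not_isFar hf, farTerm_of_not_isFar ((isFar_smul_iff ..).not.2 hf), map_zero]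

theorem farTerm_swap (hH : IsHypEmbedded X H) (hr : IsArray (leftRegular (H μ)) r) (f g : G)
    (c : G ⧸ H μ) : farTerm X D r g f c = -farTerm X D r f g c := by
  have hc := isConnected_of_closure hH.generates
  by_cases hf : IsFar X D f g c
  · rw [farTerm_of_isFar hf, farTerm_of_isFar (hf.symm hc),
      pairAvg_swap hr (finite_proj hH f c) (finite_proj hH g c)]
  · rw [farTerm_of_not_isFar hf, farTerm_of_not_isFar ((isFar_comm hc).not.2 hf), neg_zero]

theorem farTerm_apply_of_ne (hH : IsHypEmbedded X H) {f g x : G} (hx : (x : G ⧸ H μ) ≠ c) :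
    (farTerm X D r f g c : G → ℂ) x = 0 := by
  by_cases hf : IsFar X D f g c
  · rw [farTerm_of_isFar hf]
    exact pairAvg_apply_of_ne (finite_proj hH f c) (finite_proj hH g c) (fun u hu => hu.1) hx
  · simp [farTerm_of_not_isFar hf]

variable {C : ℝ≥0}

theorem finite_support_farTerm (hH : IsHypEmbedded X H) (hC : IsPolygonConstant X H C)
    (hD : 3 * C ≤ D) (r : H μ → EllTwo (H μ)) (f g : G) :
    (Function.support (farTerm X D r f g)).Finite :=
  (finite_setOf_isFar (isConnected_of_closure hH.generates) hC hD μ f g).subset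
    (support_farTerm_subset r f g)

theorem farSum_mul_left (hH : IsHypEmbedded X H) (r : H μ → EllTwo (H μ)) (h f g : G) :
    farSum X D r (h * f) (h * g) = leftRegular G h (farSum X D r f g) := by
  rw [farSum, ← finsum_comp_equiv (MulAction.toPerm h : Equiv.Perm (G ⧸ H μ)), farSum]
  simp only [MulAction.toPerm_apply, farTerm_mul_left hH]
  -- For an additive equivalence no finiteness of the support is needed.
  exact (AddEquivClass.map_finsum (leftRegular G h) _).symm

theorem farSum_swap (hH : IsHypEmbedded X H) (hr : IsArray (leftRegular (H μ)) r) (f g : G) :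
    farSum X D r g f = -farSum X D r f g := by
  rw [farSum, farSum, ← finsum_neg_distrib]
  exact finsum_congr fun c => farTerm_swap hH hr f g c

/-- The terms are supported on their own cosets, so on `c` the sum agrees with the term of `c`. -/
theorem norm_farTerm_le (hH : IsHypEmbedded X H) (hC : IsPolygonConstant X H C)
    (hD : 3 * C ≤ D) (r : H μ → EllTwo (H μ)) (f g : G) (c : G ⧸ H μ) :
    ‖farTerm X D r f g c‖ ≤ ‖farSum X D r f g‖ := by
  have hfin := finite_support_farTerm hH hC hD r f g
  refine EllTwo.norm_le_of_apply_le fun x => ?_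
  by_cases hx : (x : G ⧸ H μ) = c
  · rw [farSum, finsum_eq_sum_of_support_subset (s := hfin.toFinset) _ (by simp), lp.coeFn_sum,
      Finset.sum_apply, Finset.sum_eq_single c]
    · intro c' _ hne
      exact farTerm_apply_of_ne hH (fun e => hne (e.symm.trans hx))
    · intro hcs
      have h0 : farTerm X D r f g c = 0 := by simpa using hcs
      simp [h0]
  · rw [farTerm_apply_of_ne hH hx]
    simp

/-- The functions `r` and `β` are bounded on balls of the relative metric. -/
theorem exists_bound_on_ball (hH : IsHypEmbedded X H) (r : H μ → EllTwo (H μ)) (N : ℕ) (β : G → ℝ) :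
    ∃ M : ℝ, 0 ≤ M ∧ ∀ u v : G, (u : G ⧸ H μ) = v → relMetric X H μ u v ≤ N →
      ‖pairVec r u v‖ ≤ M ∧ β (u⁻¹ * v) ≤ M := by
  obtain ⟨M, hM⟩ := ((hH.locallyFinite μ N).image
    fun h => max ‖pairVec r 1 h‖ (β h)).bddAbove
  refine ⟨max M 0, le_max_right _ _, fun u v huv hN => ?_⟩
  have hmem : u⁻¹ * v ∈ {h : G | h ∈ H μ ∧ relMetric X H μ 1 h ≤ N} :=
    ⟨QuotientGroup.eq.1 huv, by rwa [← relMetric_eq_one_left]⟩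
  have hle := hM ⟨_, hmem, rfl⟩
  have hp : pairVec r u v = leftRegular G u (pairVec r 1 (u⁻¹ * v)) := by
    rw [← pairVec_mul_left]
    simp
  rw [hp, LinearIsometryEquiv.norm_map]
  exact ⟨((le_max_left _ _).trans hle).trans (le_max_left _ _),
    ((le_max_right _ _).trans hle).trans (le_max_left _ _)⟩

/-- Each contribution is close to the vector of any pair of projections, and projections of two
points joined by a geodesic avoiding the coset have bounded displacement. -/
theorem exists_norm_farTerm_sub_le (hH : IsHypEmbedded X H) (D : ℝ≥0) {β : G → ℝ}
    (hβ : ∀ u u' w : G, (u : G ⧸ H μ) = u' → (w : G ⧸ H μ) = u →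
      ‖pairVec r u w - pairVec r u' w‖ ≤ β (u⁻¹ * u') ∧
        ‖pairVec r w u - pairVec r w u'‖ ≤ β (u⁻¹ * u')) :
    ∃ M : ℝ, 0 ≤ M ∧
      (∀ (f g u v : G) (c : G ⧸ H μ), u ∈ proj X f c → v ∈ proj X g c →
        ‖farTerm X D r f g c - pairVec r u v‖ ≤ 2 * M) ∧
      ∀ (f g u v : G) (c : G ⧸ H μ) (w : List (OLetter X H)), IsGeodesic f g w → Avoids c f w →
        u ∈ proj X f c → v ∈ proj X g c → β (u⁻¹ * v) ≤ M := by
  obtain ⟨δ, hδ⟩ := hH.hyperbolic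
  have hc := isConnected_of_closure hH.generates
  -- The radius dominates both `D`, for cosets that are not far, and `16 * δ + 9`, for projections.
  obtain ⟨M, hM0, hM⟩ := exists_bound_on_ball hH r (⌈D⌉₊ + (16 * δ + 9)) β
  have hN : ((16 * δ + 9 : ℕ) : ℝ≥0∞) ≤ (⌈D⌉₊ + (16 * δ + 9) : ℕ) := by
    exact_mod_cast Nat.le_add_left _ _
  have hND : (D : ℝ≥0∞) ≤ (⌈D⌉₊ + (16 * δ + 9) : ℕ) := by
    have h1 : D ≤ ((⌈D⌉₊ + (16 * δ + 9) : ℕ) : ℝ≥0) :=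
      (Nat.le_ceil D).trans (by exact_mod_cast Nat.le_add_right _ _)
    exact_mod_cast h1
  refine ⟨M, hM0, fun f g u v c hu hv => ?_, fun f g u v c w hw hav hu hv => ?_⟩
  · by_cases hf : IsFar X D f g c
    · rw [farTerm_of_isFar hf]
      refine norm_pairAvg_sub_le (finite_proj hH f c) (finite_proj hH g c) ⟨u, hu⟩ ⟨v, hv⟩ ?_
      intro u' hu' v' hv'
      have h1 := (hβ u' u v' (hu'.1.trans hu.1.symm) (hv'.1.trans hu'.1.symm)).1
      have h2 := (hβ v' v u (hv'.1.trans hv.1.symm) (hu.1.trans hv'.1.symm)).2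
      have h3 := (hM u' u (hu'.1.trans hu.1.symm)
        ((relMetric_le_of_mem_proj hδ hc hu' hu).trans hN)).2
      have h4 := (hM v' v (hv'.1.trans hv.1.symm)
        ((relMetric_le_of_mem_proj hδ hc hv' hv).trans hN)).2
      -- One point is moved at a time, at a cost of at most `M` each.
      calc ‖pairVec r u' v' - pairVec r u v‖
          ≤ ‖pairVec r u' v' - pairVec r u v'‖ + ‖pairVec r u v' - pairVec r u v‖ :=
            norm_sub_le_norm_sub_add_norm_sub ..
        _ ≤ 2 * M := by linarith
    · rw [farTerm_of_not_isFar hf, zero_sub, norm_neg]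
      have h1 := (hM u v (hu.1.trans hv.1.symm)
        ((relMetric_le_of_not_isFar hδ hc hf hu hv).trans (max_le hND hN))).1
      linarith
  · exact (hM u v (hu.1.trans hv.1.symm)
      ((relMetric_le_of_avoids hδ hc hw hav hu hv).trans hN)).2

/-- Apart from the finitely many cosets met by `γ` and one exception, the terms cancel; those that
remain are bounded independently of `k`. -/
theorem exists_norm_farSum_sub_le (hH : IsHypEmbedded X H) (hC : IsPolygonConstant X H C)
    (hD : 3 * C ≤ D) (hr : IsArray (leftRegular (H μ)) r) (f g : G) :
    ∃ B : ℝ, ∀ k : G, ‖farSum X D r f k - farSum X D r g k‖ ≤ B := by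
  classical
  have hc := isConnected_of_closure hH.generates
  obtain ⟨β, hβ⟩ := exists_norm_pairVec_sub_le hr
  obtain ⟨M, hM0, hM, hMβ⟩ := exists_norm_farTerm_sub_le hH D hβ
  obtain ⟨γ, hγ⟩ := exists_isGeodesic hc f g
  have hZ := finite_setOf_not_avoids μ f γ
  choose a ha using fun c : G ⧸ H μ => proj_nonempty (X := X) f c
  choose b hb using fun c : G ⧸ H μ => proj_nonempty (X := X) g c
  -- On the cosets met by `γ` the displacement from `a c` to `b c` has no uniform bound, but there
  -- are finitely many of them, and they do not depend on `k`.
  obtain ⟨B, hB⟩ := (hZ.image fun c => β ((a c)⁻¹ * b c)).bddAbove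
  have hterm : ∀ k c, ‖farTerm X D r f k c - farTerm X D r g k c‖ ≤ 4 * M + max B M := by
    intro k c
    obtain ⟨w, hw⟩ := proj_nonempty (X := X) k c
    have h1 := hM f k _ w c (ha c) hw
    have h2 := hM g k _ w c (hb c) hw
    have h3 := (hβ (a c) (b c) w ((ha c).1.trans (hb c).1.symm) (hw.1.trans (ha c).1.symm)).1
    have h4 : β ((a c)⁻¹ * b c) ≤ max B M := by
      by_cases hav : Avoids c f γ
      · exact (hMβ f g _ _ c γ hγ hav (ha c) (hb c)).trans (le_max_right _ _)
      · exact (hB ⟨c, hav, rfl⟩).trans (le_max_left _ _)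
    rw [norm_sub_rev] at h2
    have h5 := norm_sub_le_norm_sub_add_norm_sub (farTerm X D r f k c) (pairVec r (a c) w)
      (farTerm X D r g k c)
    have h6 := norm_sub_le_norm_sub_add_norm_sub (pairVec r (a c) w) (pairVec r (b c) w)
      (farTerm X D r g k c)
    linarith
  -- The exceptional coset depends on `k`, but it only adds 1 to the number of terms.
  refine ⟨(hZ.toFinset.card + 1) * (4 * M + max B M), fun k => ?_⟩
  obtain ⟨c', hc'⟩ := exists_forall_proj_eq hc hC hD μ hγ k
  have hsupp : (Function.support fun c => farTerm X D r f k c - farTerm X D r g k c) ⊆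
      (insert c' hZ.toFinset : Finset (G ⧸ H μ)) := by
    intro c hcs
    by_contra hmem
    simp only [Finset.coe_insert, Set.Finite.coe_toFinset, Set.mem_insert_iff, not_or] at hmem
    refine hcs ?_
    have hav : Avoids c f γ := by
      by_contra h
      exact hmem.2 h
    by_cases hfar : IsFar X D f k c ∨ IsFar X D g k c
    · obtain ⟨hp, hiff⟩ := hc' c hav hmem.1 hfar
      have hfk : IsFar X D f k c := hfar.elim id hiff.2
      simp only [farTerm_of_isFar hfk, farTerm_of_isFar (hiff.1 hfk), hp, sub_self]
    · rw [not_or] at hfar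
      simp only [farTerm_of_not_isFar hfar.1, farTerm_of_not_isFar hfar.2, sub_self]
  rw [farSum, farSum, ← finsum_sub_distrib (finite_support_farTerm hH hC hD r f k)
    (finite_support_farTerm hH hC hD r g k), finsum_eq_sum_of_support_subset _ hsupp]
  refine (norm_sum_le_of_le _ fun c _ => hterm k c).trans ?_
  rw [Finset.sum_const, nsmul_eq_mul]
  refine mul_le_mul_of_nonneg_right ?_ (by have := le_max_right B M; linarith)
  exact_mod_cast Finset.card_insert_le _ _

/-- By equivariance, `g` translates `farSum 1 h` to `farSum g (g * h)`, so the array defect is a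
change of the first point from `1` to `g`. -/
theorem isArray_farSum (hH : IsHypEmbedded X H) (hC : IsPolygonConstant X H C)
    (hD : 3 * C ≤ D) (hr : IsArray (leftRegular (H μ)) r) :
    IsArray (leftRegular G) (farSum X D r 1) where
  antisymm g := by
    rw [← farSum_mul_left hH, ← farSum_swap hH hr]
    simp
  bounded g := by
    obtain ⟨B, hB⟩ := exists_norm_farSum_sub_le hH hC hD hr 1 g
    refine ⟨B, ?_⟩
    rintro _ ⟨h, rfl⟩
    dsimp only
    rw [← farSum_mul_left hH, mul_one]
    exact hB (g * h)

end RelCayley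

theorem proposition3p7 {G : Type*} [Group G] {Λ : Type*} (X : Set G) (H : Λ → Subgroup G)
    (hH : RelCayley.IsHypEmbedded X H) :
    (∃ C : ℝ≥0, 0 < C ∧ RelCayley.IsPolygonConstant X H C) ∧
    ∀ C : ℝ≥0, 0 < C → RelCayley.IsPolygonConstant X H C →
    ∀ D : ℝ≥0, 3 * C ≤ D →
    ∀ (μ : Λ) (r : H μ → EllTwo (H μ)), IsArray (leftRegular (H μ)) r →
      ∃ R : G → EllTwo G, IsArray (leftRegular G) R ∧ ∃ K : ℝ, 0 ≤ K ∧
        ∀ (g : G) (c : G ⧸ H μ), RelCayley.IsSeparating X H μ D 1 g c →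
        ∀ p : List (RelCayley.OLetter X H), RelCayley.IsGeodesic 1 g p →
          (∃ u v : G, RelCayley.Penetrates μ 1 p c u v) ∧
          ∀ (u v : G) (huv : RelCayley.Penetrates μ 1 p c u v),
            ‖r ⟨u⁻¹ * v, huv.mem⟩‖ ≤ ‖R g‖ + K := by
  have hc := RelCayley.isConnected_of_closure hH.generates
  refine ⟨?_, fun C _ hC D hD μ r hr => ?_⟩
  · obtain ⟨δ, hδ⟩ := hH.hyperbolic
    refine ⟨(4 * (16 * δ + 9) : ℕ), ?_, RelCayley.isPolygonConstant_of_thinTriangles hδ hc⟩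
    exact_mod_cast (by omega : 0 < 4 * (16 * δ + 9))
  obtain ⟨β, hβ⟩ := exists_norm_pairVec_sub_le hr
  obtain ⟨M, hM0, hM, -⟩ := RelCayley.exists_norm_farTerm_sub_le hH D hβ
  refine ⟨RelCayley.farSum X D r 1, RelCayley.isArray_farSum hH hC hD hr, 2 * M, by positivity,
    fun g c hsep p hp => ⟨?_, fun u v huv => ?_⟩⟩
  · exact RelCayley.exists_penetrates ((hsep.isFar hc).meets hc hC hD p hp)
  · obtain ⟨x, s, y, rfl, hs, hx, hu, hv⟩ := huv.exists_edge hp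
    -- The entrance and exit points of any geodesic are projections, so their vector is within `2 *
    -- M` of the term of `c`.
    obtain ⟨-, hup, hvp, -⟩ := hp.edge_in_coset hc hs hx
    rw [← hu] at hup
    rw [← hv] at hvp
    rw [← norm_pairVec huv.mem]
    have h1 := hM 1 g u v c hup hvp
    have h2 := RelCayley.norm_farTerm_le hH hC hD r 1 g c
    have h3 := norm_le_norm_add_norm_sub (RelCayley.farTerm X D r 1 g c) (pairVec r u v)
    linarith

end
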